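/- \textbf{Setting.} Let $\Delta$ be an unbounded positive self-adjoint operator on a complex Hilbert space $H$ with $0\notin\mathrm{spec}(\Delta)$ and compact resolvent; put $H^\infty=\bigcap_{k\ge0}\mathrm{dom}(\Delta^k)$, and let $\Delta^w:H^\infty\to H^\infty$ ($w\in\mathbb C$) be the complex powers given by the spectral theorem. An \emph{algebra of abstract differential operators} of order $r>0$ is an algebra $\mathcal D=\bigcup_{q\in\mathbb N}\mathcal D_q$ of operators on $H^\infty$, filtered by an increasing family of subspaces with $\mathcal D_p\mathcal D_q\subset\mathcal D_{p+q}$, such that $[\Delta,\mathcal D_q]\subset\mathcal D_{r+q-1}$ (for non-integral $r+q-1$: contained in $\mathcal D_n$ for all integers $n\ge r+q-1$, $n\ge 0$), and such that for each $X\in\mathcal D_q$ there is $\varepsilon>0$ with $\|v\|_q+\|v\|\ge\varepsilon\|Xv\|$ for all $v\in H^\infty$, where $\|v\|_s=(\|v\|^2+\|\Delta^{s/r}v\|^2)^{1/2}$. For an operator $P$ on $H^\infty$ write $\zeta_P(z)=\mathrm{Tr}(P\Delta^{-z/r})$ when $P\Delta^{-z/r}$ extends to a trace-class operator on $H$. Suppose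 that $\mathcal D$ has analytic dimension $d$, i.e. $d$ is the smallest $d\ge0$ such that $X\Delta^{-z}$ extends to a trace-class operator on $H$ whenever $X\in\mathcal D_q$ and $\Re z>(q+d)/r$, and that $\zeta_X$ extends meromorphically to $\mathbb C$ for every $X\in\mathcal D$. An \emph{algebra of abstract pseudodifferential operators} is an (associative, not necessarily unital) algebra $\Psi=\Psi(\Delta)=\bigcup_{m\in\mathbb R}\Psi^m$ of operators on $H^\infty$, filtered by an increasing family of subspaces with $\Psi^m\Psi^n\subset\Psi^{m+n}$, such that for all $m\in\mathbb R$, $z\in\mathbb C$ and $P\in\Psi^m$: (a) for every $s\ge0$, $P$ extends to a bounded operator from $(H^{m+s},\|\cdot\|_{m+s})$ to $(H^s,\|\cdot\|_s)$, where $H^s=\mathrm{dom}(\Delta^{s/r})$; and if $m<-d$, then $P$ extends to a trace-class operator on $H$; (b) $\Delta^{z/r}P\in\Psi^{\Re z+m}$, $P\Delta^{z/r}\in\Psi^{\Re z+m}$ and $[\Delta^{z/r},P]\in\Psi^{\Re z+m-1}$; (c) $\zeta_P$ is holomorphic on $\{\Re z>m+d\}$ and extends to a meromorphic function on $\mathbb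 C$, still denoted by $\zeta_P$. \textbf{Proposition.} Let $\Psi(\Delta)$ be an algebra of abstract pseudodifferential operators, and suppose that its zeta function has a pole of order $p\ge1$ at $z=0$, i.e. for every $P\in\Psi(\Delta)$ the function $\zeta_P$ has at $0$ at most a pole of order $p$, and order $p$ is attained for some $P$. Then the functional $$P\longmapsto \mathrm{Res}_{z=0}\; z^{p-1}\,\zeta_P(z)=\mathrm{Res}_{z=0}\; z^{p-1}\,\mathrm{Tr}(P\Delta^{-z/r})$$ is a trace on $\Psi(\Delta)$: it is $\mathbb C$-linear and takes the same value on $PQ$ and $QP$ for all $P,Q\in\Psi(\Delta)$. -/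

import Mathlib

open Filter Topology
open scoped InnerProductSpace

namespace AbstractPDO

/-- The domain of the power `Δ ^ k` of an unbounded operator: `v ∈ dom (Δ ^ (k + 1))` iff
`v ∈ dom Δ` and `Δ v ∈ dom (Δ ^ k)`. -/
def domPow {H : Type*} [NormedAddCommGroup H] [InnerProductSpace ℂ H]
    (Δ : H →ₗ.[ℂ] H) : ℕ → Submodule ℂ H
  | 0 => ⊤
  | k + 1 => ((domPow Δ k).comap Δ.toFun).map Δ.domain.subtype

theorem mem_domPow_succ {H : Type*} [NormedAddCommGroup H] [InnerProductSpace ℂ H]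
    (Δ : H →ₗ.[ℂ] H) (k : ℕ) (v : H) :
    v ∈ domPow Δ (k + 1) ↔ ∃ h : v ∈ Δ.domain, Δ ⟨v, h⟩ ∈ domPow Δ k := by
  simp only [domPow, Submodule.mem_map, Submodule.mem_comap]
  constructor
  · rintro ⟨⟨x, hx⟩, h1, rfl⟩
    exact ⟨hx, h1⟩
  · rintro ⟨h, h1⟩
    exact ⟨⟨v, h⟩, h1, rfl⟩

/-- An unbounded, positive, self-adjoint operator on a complex Hilbert space whose spectrum does not
contain `0` and which has compact resolvent, that is: the everywhere defined inverse exists and is a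
compact operator. -/
structure PositiveOperator (H : Type*) [NormedAddCommGroup H] [InnerProductSpace ℂ H]
    [CompleteSpace H] where
  op : H →ₗ.[ℂ] H
  selfAdjoint : IsSelfAdjoint op
  nonneg : ∀ v : op.domain, 0 ≤ (⟪(v : H), op v⟫_ℂ).re
  compact_inverse : ∃ R : H →L[ℂ] H, IsCompactOperator R ∧
    (∀ v : H, ∃ h : R v ∈ op.domain, op ⟨R v, h⟩ = v) ∧ ∀ v : op.domain, R (op v) = v

namespace PositiveOperator

variable {H : Type*} [NormedAddCommGroup H] [InnerProductSpace ℂ H] [CompleteSpace H]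

/-- `H^∞ = ⋂ k, dom (Δ ^ k)`. -/
def smooth (S : PositiveOperator H) : Submodule ℂ H := ⨅ k : ℕ, domPow S.op k

theorem mem_smooth (S : PositiveOperator H) (v : H) :
    v ∈ S.smooth ↔ ∀ k, v ∈ domPow S.op k := by
  simp [smooth, Submodule.mem_iInf]

theorem smooth_domain (S : PositiveOperator H) {v : H} (hv : v ∈ S.smooth) :
    ∃ h : v ∈ S.op.domain, S.op ⟨v, h⟩ ∈ S.smooth := by
  rw [mem_smooth] at hv
  obtain ⟨h, -⟩ := (mem_domPow_succ _ _ _).1 (hv 1)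
  refine ⟨h, (mem_smooth _ _).2 fun k => ?_⟩
  exact ((mem_domPow_succ _ _ _).1 (hv (k + 1))).2

/-- `Δ` as a linear operator `H^∞ → H^∞`. -/
def lap (S : PositiveOperator H) : Module.End ℂ S.smooth where
  toFun v := ⟨S.op ⟨v, (S.smooth_domain v.2).1⟩, (S.smooth_domain v.2).2⟩
  map_add' v w := by
    apply Subtype.ext
    exact S.op.map_add ⟨v, _⟩ ⟨w, _⟩
  map_smul' c v := by
    apply Subtype.ext
    exact S.op.map_smul c ⟨v, _⟩

/-- `e` is an eigenvector of `Δ` for the eigenvalue `μ` (or `e = 0`). -/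
def IsEigen (S : PositiveOperator H) (μ : ℝ) (e : H) : Prop :=
  ∃ h : e ∈ S.op.domain, S.op ⟨e, h⟩ = (μ : ℂ) • e

theorem inverse_symm (S : PositiveOperator H) (R : H →L[ℂ] H)
    (hR : ∀ v : H, ∃ h : R v ∈ S.op.domain, S.op ⟨R v, h⟩ = v) :
    (R : H →ₗ[ℂ] H).IsSymmetric := by
  intro x y
  have hd := S.selfAdjoint.dense_domain
  have h1 := LinearPMap.adjoint_isFormalAdjoint (T := S.op) hd
  rw [LinearPMap.isSelfAdjoint_def.1 S.selfAdjoint] at h1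
  obtain ⟨hx, hx'⟩ := hR x
  obtain ⟨hy, hy'⟩ := hR y
  have := h1 ⟨R x, hx⟩ ⟨R y, hy⟩
  rw [hx', hy'] at this
  simpa using this.symm

/-- The eigenvectors of `Δ` span a dense subspace. -/
theorem eigen_total (S : PositiveOperator H) (u : H)
    (hu : ∀ (μ : ℝ) (e : H), S.IsEigen μ e → ⟪e, u⟫_ℂ = 0) : u = 0 := by
  obtain ⟨R, hRc, hR, hR'⟩ := S.compact_inverse
  have hsym := S.inverse_symm R hR
  have hbot := ContinuousLinearMap.orthogonalComplement_iSup_eigenspaces_eq_bot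
    (T := R) hRc hsym
  have : u ∈ (⨆ μ, Module.End.eigenspace (R : H →ₗ[ℂ] H) μ)ᗮ := by
    rw [← Submodule.iInf_orthogonal, Submodule.mem_iInf]
    intro ν
    rw [Submodule.mem_orthogonal]
    intro e he
    have he' : R e = ν • e := by simpa using Module.End.mem_eigenspace_iff.1 he
    obtain ⟨h, hRe⟩ := hR e
    by_cases he0 : e = 0
    · simp [he0]
    have hν : ν ≠ 0 := by
      rintro rfl
      apply he0
      rw [← hRe]
      have : (⟨R e, h⟩ : S.op.domain) = 0 := by
        apply Subtype.ext; simpa using he'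
      rw [this, LinearPMap.map_zero]
    have hconj : (starRingEnd ℂ) ν = ν := hsym.conj_eigenvalue_eq_self
      (Module.End.hasEigenvalue_of_hasEigenvector (Module.End.hasEigenvector_iff.2 ⟨he, he0⟩))
    obtain ⟨t, rfl⟩ := Complex.conj_eq_iff_real.1 hconj
    have hmem : e ∈ S.op.domain := by
      have : e = (t : ℂ)⁻¹ • R e := by rw [he', smul_smul, inv_mul_cancel₀ hν, one_smul]
      rw [this]
      exact S.op.domain.smul_mem _ h
    refine hu t⁻¹ e ⟨hmem, ?_⟩
    have h2 : (⟨R e, h⟩ : S.op.domain) = (t : ℂ) • ⟨e, hmem⟩ := by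
      apply Subtype.ext; simpa using he'
    rw [h2, LinearPMap.map_smul] at hRe
    calc S.op ⟨e, hmem⟩ = (t : ℂ)⁻¹ • ((t : ℂ) • S.op ⟨e, hmem⟩) := by
          rw [smul_smul, inv_mul_cancel₀ hν, one_smul]
      _ = ((t⁻¹ : ℝ) : ℂ) • e := by rw [hRe]; push_cast; rfl
  rw [hbot] at this
  simpa using this

theorem exists_multiplier (R : H →L[ℂ] H) (hRc : IsCompactOperator R)
    (hsym : (R : H →ₗ[ℂ] H).IsSymmetric) (c : ℂ → ℂ) (M : ℝ) (hc : ∀ ν, ‖c ν‖ ≤ M) (x : H) :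
    ∃ u : H, ∀ (ν : ℂ) (e : H), R e = ν • e → ⟪e, u⟫_ℂ = c ν * ⟪e, x⟫_ℂ := by
  classical
  let G : ℂ → Submodule ℂ H := fun ν => Module.End.eigenspace (R : H →ₗ[ℂ] H) ν
  have hclosed : ∀ ν, IsClosed (G ν : Set H) := by
    intro ν
    have : (G ν : Set H) = {e | R e = ν • e} := by
      ext e; simp [G]
    rw [this]
    exact isClosed_eq R.continuous (continuous_const_smul ν)
  have : ∀ ν, CompleteSpace (G ν) := fun ν => (hclosed ν).completeSpace_coe
  have hV : IsHilbertSum ℂ (fun ν => G ν) fun ν => (G ν).subtypeₗᵢ := by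
    refine IsHilbertSum.mkInternal _ hsym.orthogonalFamily_eigenspaces ?_
    refine (Submodule.topologicalClosure_eq_top_iff.2 ?_).ge
    exact ContinuousLinearMap.orthogonalComplement_iSup_eigenspaces_eq_bot (T := R) hRc hsym
  let L := hV.linearIsometryEquiv
  let f := L x
  have hg : Memℓp (fun ν => c ν • f ν) 2 := by
    refine Memℓp.mono' ((lp.memℓp f).norm.const_smul M) ?_
    intro ν
    rw [norm_smul]
    have hM : 0 ≤ M := (norm_nonneg _).trans (hc 0)
    simpa [abs_of_nonneg hM] using mul_le_mul_of_nonneg_right (hc ν) (norm_nonneg (f ν))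
  let g : lp (fun ν => G ν) 2 := ⟨fun ν => c ν • f ν, hg⟩
  have key : ∀ (ν : ℂ) (e : G ν) (h : lp (fun ν => G ν) 2),
      ⟪(e : H), L.symm h⟫_ℂ = ⟪e, h ν⟫_ℂ := by
    intro ν e h
    have h1 : L.symm (lp.single 2 ν e) = (e : H) :=
      hV.linearIsometryEquiv_symm_apply_single e
    rw [← h1, LinearIsometryEquiv.inner_map_map, lp.inner_single_left]
  refine ⟨L.symm g, fun ν e he => ?_⟩
  have he' : e ∈ G ν := by simpa [G, Module.End.mem_eigenspace_iff] using he
  have h1 := key ν ⟨e, he'⟩ g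
  have h2 := key ν ⟨e, he'⟩ f
  have h3 : L.symm f = x := L.symm_apply_apply x
  rw [h3] at h2
  simp only at h1 h2
  rw [h1, h2]
  change ⟪(⟨e, he'⟩ : G ν), c ν • f ν⟫_ℂ = _
  rw [inner_smul_right]

theorem eigen_inverse (S : PositiveOperator H) (R : H →L[ℂ] H)
    (hR : ∀ v : S.op.domain, R (S.op v) = v) {μ : ℝ} {e : H} (he : S.IsEigen μ e)
    (he0 : e ≠ 0) : 0 < μ ∧ R e = (μ : ℂ)⁻¹ • e := by
  obtain ⟨h, h1⟩ := he
  have h2 := hR ⟨e, h⟩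
  rw [h1, map_smul] at h2
  simp only at h2
  have hμ : (μ : ℂ) ≠ 0 := by
    intro h0
    rw [h0, zero_smul] at h2
    exact he0 h2.symm
  have hnn := S.nonneg ⟨e, h⟩
  rw [h1, inner_smul_right] at hnn
  rw [Complex.re_ofReal_mul] at hnn
  have hpos : 0 < ‖e‖ ^ 2 := by positivity
  have hin : (⟪e, e⟫_ℂ).re = ‖e‖ ^ 2 := by
    rw [← inner_self_eq_norm_sq (𝕜 := ℂ)]; rfl
  have hμ0 : 0 ≤ μ := by
    refine nonneg_of_mul_nonneg_left ?_ hpos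
    rw [← hin]; exact hnn
  refine ⟨lt_of_le_of_ne hμ0 (fun h => hμ (by simp [← h])), ?_⟩
  conv_rhs => rw [← h2]
  rw [smul_smul, inv_mul_cancel₀ hμ, one_smul]

theorem exists_pow_inverse (S : PositiveOperator H) (R : H →L[ℂ] H)
    (hR : ∀ v : S.op.domain, R (S.op v) = v) (k : ℕ) :
    ∀ v ∈ domPow S.op k, ∃ x, (R ^ k) x = v := by
  induction k with
  | zero => intro v _; exact ⟨v, by simp⟩
  | succ k ih =>
    intro v hv
    obtain ⟨h, h1⟩ := (mem_domPow_succ _ _ _).1 hv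
    obtain ⟨x, hx⟩ := ih _ h1
    exact ⟨x, by rw [pow_succ', mul_apply_eq_comp, hx, hR]⟩

theorem pow_inverse_mem (S : PositiveOperator H) (R : H →L[ℂ] H)
    (hR : ∀ v : H, ∃ h : R v ∈ S.op.domain, S.op ⟨R v, h⟩ = v) (k : ℕ) (x : H) :
    (R ^ k) x ∈ domPow S.op k := by
  induction k with
  | zero => simp [domPow]
  | succ k ih =>
    rw [pow_succ', mul_apply_eq_comp, mem_domPow_succ]
    obtain ⟨h, h1⟩ := hR ((R ^ k) x)
    exact ⟨h, by rw [h1]; exact ih⟩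

theorem inner_pow_inverse (R : H →L[ℂ] H) (hsym : (R : H →ₗ[ℂ] H).IsSymmetric) {μ : ℝ} {e : H}
    (he : R e = (μ : ℂ)⁻¹ • e) (k : ℕ) (x : H) :
    ⟪e, (R ^ k) x⟫_ℂ = ((μ : ℂ)⁻¹) ^ k * ⟪e, x⟫_ℂ := by
  induction k with
  | zero => simp
  | succ k ih =>
    have h1 : ⟪R e, (R ^ k) x⟫_ℂ = ⟪e, R ((R ^ k) x)⟫_ℂ := hsym e ((R ^ k) x)
    rw [pow_succ', mul_apply_eq_comp, ← h1, he, inner_smul_left, ih, pow_succ']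
    simp [mul_assoc]

theorem exists_cpow_aux (S : PositiveOperator H) (w : ℂ) (v : H) (hv : v ∈ S.smooth) :
    ∃ u : H, ∀ (μ : ℝ) (e : H), S.IsEigen μ e → ⟪e, u⟫_ℂ = (μ : ℂ) ^ w * ⟪e, v⟫_ℂ := by
  obtain ⟨R, hRc, hR, hR'⟩ := S.compact_inverse
  have hsym := S.inverse_symm R hR
  obtain ⟨k, hk⟩ := exists_nat_ge w.re
  obtain ⟨x, rfl⟩ := S.exists_pow_inverse R hR' k v ((S.mem_smooth v).1 hv k)
  let M : ℝ := ‖R‖ ^ ((k : ℝ) - w.re)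
  have hM : 0 ≤ M := Real.rpow_nonneg (norm_nonneg _) _
  let c : ℂ → ℂ := fun ν => if ‖ν ^ ((k : ℂ) - w)‖ ≤ M then ν ^ ((k : ℂ) - w) else 0
  have hc : ∀ ν, ‖c ν‖ ≤ M := by
    intro ν
    simp only [c]
    split_ifs with h
    · exact h
    · simpa using hM
  obtain ⟨u, hu⟩ := exists_multiplier R hRc hsym c M hc x
  refine ⟨u, fun μ e he => ?_⟩
  by_cases he0 : e = 0
  · simp [he0]
  obtain ⟨hμ, hRe⟩ := S.eigen_inverse R hR' he he0
  have hμc : (μ : ℂ) ≠ 0 := by exact_mod_cast hμ.ne'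
  rw [hu _ e hRe, inner_pow_inverse R hsym hRe, ← mul_assoc]
  congr 1
  have hle : μ⁻¹ ≤ ‖R‖ := by
    have h1 := R.le_opNorm e
    rw [hRe, norm_smul] at h1
    have h2 := le_of_mul_le_mul_right h1 (norm_pos_iff.2 he0)
    simpa [abs_of_pos hμ] using h2
  have hcond : ‖((μ : ℂ)⁻¹) ^ ((k : ℂ) - w)‖ ≤ M := by
    rw [← Complex.ofReal_inv, Complex.norm_cpow_eq_rpow_re_of_pos (inv_pos.2 hμ)]
    simp only [Complex.sub_re, Complex.natCast_re, M]
    exact Real.rpow_le_rpow (inv_pos.2 hμ).le hle (by linarith)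
  simp only [c, if_pos hcond]
  have harg : (μ : ℂ).arg ≠ Real.pi := by
    rw [Complex.arg_ofReal_of_nonneg hμ.le]; exact Real.pi_pos.ne
  rw [Complex.inv_cpow _ _ harg, Complex.cpow_sub _ _ hμc, Complex.cpow_natCast, inv_pow]
  have := pow_ne_zero k hμc
  field_simp

/-- Spectral functional calculus on `H^∞`: for every `w ∈ ℂ` there is exactly one operator
`T : H^∞ → H^∞` that multiplies the component along each eigenvector of `Δ`, with eigenvalue
`μ > 0`, by `μ ^ w`. -/
theorem existsUnique_cpow (S : PositiveOperator H) (w : ℂ) :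
    ∃! T : Module.End ℂ S.smooth, ∀ (v : S.smooth) (μ : ℝ) (e : H), S.IsEigen μ e →
      ⟪e, (T v : H)⟫_ℂ = (μ : ℂ) ^ w * ⟪e, (v : H)⟫_ℂ := by
  have huniq : ∀ u u' : H,
      (∀ (μ : ℝ) (e : H), S.IsEigen μ e → ⟪e, u⟫_ℂ = ⟪e, u'⟫_ℂ) → u = u' := by
    intro u u' h
    refine sub_eq_zero.1 (S.eigen_total _ fun μ e he => ?_)
    rw [inner_sub_right, h μ e he, sub_self]
  have hmem : ∀ (v : S.smooth) (u : H),
      (∀ (μ : ℝ) (e : H), S.IsEigen μ e → ⟪e, u⟫_ℂ = (μ : ℂ) ^ w * ⟪e, (v : H)⟫_ℂ) →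
      u ∈ S.smooth := by
    intro v u hu
    rw [mem_smooth]
    intro k
    obtain ⟨R, hRc, hR, hR'⟩ := S.compact_inverse
    have hsym := S.inverse_symm R hR
    obtain ⟨u', hu'⟩ := S.exists_cpow_aux (w + k) v v.2
    have : u = (R ^ k) u' := by
      refine huniq _ _ fun μ e he => ?_
      by_cases he0 : e = 0
      · simp [he0]
      obtain ⟨hμ, hRe⟩ := S.eigen_inverse R hR' he he0
      have hμc : (μ : ℂ) ≠ 0 := by exact_mod_cast hμ.ne'
      rw [hu μ e he, inner_pow_inverse R hsym hRe, hu' μ e he, Complex.cpow_add _ _ hμc,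
        Complex.cpow_natCast, inv_pow]
      have := pow_ne_zero k hμc
      field_simp
    rw [this]
    exact S.pow_inverse_mem R hR k u'
  choose F hF using fun v : S.smooth => S.exists_cpow_aux w v v.2
  refine ⟨{ toFun := fun v => ⟨F v, hmem v _ (hF v)⟩, map_add' := ?_, map_smul' := ?_ },
    fun v μ e he => hF v μ e he, ?_⟩
  · intro a b
    apply Subtype.ext
    refine huniq _ _ fun μ e he => ?_
    simp only [Submodule.coe_add]
    rw [hF _ μ e he, inner_add_right, hF _ μ e he, hF _ μ e he, Submodule.coe_add,
      inner_add_right, mul_add]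
  · intro a b
    apply Subtype.ext
    refine huniq _ _ fun μ e he => ?_
    simp only [Submodule.coe_smul, RingHom.id_apply]
    rw [hF _ μ e he, inner_smul_right, hF _ μ e he, Submodule.coe_smul, inner_smul_right]
    ring
  · intro T hT
    ext v
    refine huniq _ _ fun μ e he => ?_
    rw [hT v μ e he]
    exact (hF v μ e he).symm

/-- The complex power `Δ ^ w : H^∞ → H^∞`, for `w ∈ ℂ`, given by the spectral functional calculus
(with the principal branch of `μ ^ w` on the positive eigenvalues `μ`). -/
noncomputable def cpow (S : PositiveOperator H) (w : ℂ) : Module.End ℂ S.smooth :=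
  (S.existsUnique_cpow w).exists.choose

theorem cpow_spec (S : PositiveOperator H) (w : ℂ) (v : S.smooth) (μ : ℝ) (e : H)
    (he : S.IsEigen μ e) :
    ⟪e, (S.cpow w v : H)⟫_ℂ = (μ : ℂ) ^ w * ⟪e, (v : H)⟫_ℂ :=
  (S.existsUnique_cpow w).exists.choose_spec v μ e he

/-- The norm of the Sobolev space `H ^ s`, on its dense subspace `H^∞`, where `r` is the order
of `Δ`: `‖v‖_s = (‖v‖² + ‖Δ ^ (s / r) v‖²) ^ (1 / 2)`. -/
noncomputable def sobolevNorm (S : PositiveOperator H) (r s : ℝ) (v : S.smooth) : ℝ :=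
  Real.sqrt (‖(v : H)‖ ^ 2 + ‖(S.cpow ((s / r : ℝ) : ℂ) v : H)‖ ^ 2)

end PositiveOperator

section TraceClass

variable {H : Type*} [NormedAddCommGroup H] [InnerProductSpace ℂ H] [CompleteSpace H]

/-- Trace-class operators on a Hilbert space: the operators `A = ∑ n, ⟪x n, ·⟫ y n` with
`∑ n, ‖x n‖ ‖y n‖ < ∞`. -/
def IsTraceClass (A : H →L[ℂ] H) : Prop :=
  ∃ x y : ℕ → H, Summable (fun n => ‖x n‖ * ‖y n‖) ∧
    ∀ v : H, HasSum (fun n => ⟪x n, v⟫_ℂ • y n) (A v)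

/-- The trace `∑ i, ⟪b i, A (b i)⟫` of a trace-class operator; the sum converges absolutely and is
the same for every Hilbert basis `b`. -/
noncomputable def trace (A : H →L[ℂ] H) : ℂ :=
  ∑' i, ⟪(exists_hilbertBasis ℂ H).choose_spec.choose i,
    A ((exists_hilbertBasis ℂ H).choose_spec.choose i)⟫_ℂ

end TraceClass

/-- `a` is the residue of `f` at the isolated singularity `c`: it is the value of
`(2πi)⁻¹ ∮ f` over all sufficiently small circles around `c`. -/
def HasResidueAt (f : ℂ → ℂ) (c a : ℂ) : Prop :=
  ∀ᶠ ρ in 𝓝[>] (0 : ℝ), CircleIntegrable f c ρ ∧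
    (2 * (Real.pi : ℂ) * Complex.I)⁻¹ * (∮ z in C(c, ρ), f z) = a

namespace PositiveOperator

variable {H : Type*} [NormedAddCommGroup H] [InnerProductSpace ℂ H] [CompleteSpace H]

/-- `T : H^∞ → H^∞` extends to a trace-class operator on `H`. -/
def ExtendsToTraceClass (S : PositiveOperator H) (T : Module.End ℂ S.smooth) : Prop :=
  ∃ A : H →L[ℂ] H, IsTraceClass A ∧ ∀ v : S.smooth, A v = T v

open Classical in
/-- The trace of an operator on `H^∞` that extends to a trace-class operator on `H` (the extension
is unique, as `H^∞` is dense); the value `0` otherwise is never used. -/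
noncomputable def Tr (S : PositiveOperator H) (T : Module.End ℂ S.smooth) : ℂ :=
  if h : S.ExtendsToTraceClass T then trace h.choose else 0

/-- The zeta function `ζ_P(z) = Tr (P Δ ^ (-z / r))`, where `r` is the order of `Δ`. -/
noncomputable def zeta (S : PositiveOperator H) (r : ℝ) (P : Module.End ℂ S.smooth) (z : ℂ) : ℂ :=
  S.Tr (P * S.cpow (-z / r))

/-- `F` is a meromorphic function on the whole plane that continues the zeta function of `P` from
some right half-plane. Up to its values on a discrete set, `F` is unique. -/
def IsZetaContinuation (S : PositiveOperator H) (r : ℝ) (P : Module.End ℂ S.smooth)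
    (F : ℂ → ℂ) : Prop :=
  Meromorphic F ∧ ∃ c : ℝ, ∀ z : ℂ, c < z.re → F z = S.zeta r P z

/-- An algebra of abstract differential operators associated to `Δ`, with order `r` of `Δ`. In
`comm_mem`, an operator of order at most the real number `r + q - 1` is one that lies in
`filt n` for all natural numbers `n ≥ r + q - 1`. -/
structure DiffOpAlgebra (S : PositiveOperator H) where
  filt : ℕ → Submodule ℂ (Module.End ℂ S.smooth)
  mono : Monotone filt
  mul_mem : ∀ (p q : ℕ) (X Y : Module.End ℂ S.smooth),
    X ∈ filt p → Y ∈ filt q → X * Y ∈ filt (p + q)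
  order : ℝ
  order_pos : 0 < order
  comm_mem : ∀ (q n : ℕ) (X : Module.End ℂ S.smooth), X ∈ filt q → order + q - 1 ≤ n →
    S.lap * X - X * S.lap ∈ filt n
  elliptic : ∀ (q : ℕ) (X : Module.End ℂ S.smooth), X ∈ filt q → ∃ ε : ℝ, 0 < ε ∧
    ∀ v : S.smooth, ε * ‖(X v : H)‖ ≤ S.sobolevNorm order q v + ‖(v : H)‖

namespace DiffOpAlgebra

variable {S : PositiveOperator H}

/-- `d` is the analytic dimension: the smallest `d ≥ 0` such that `X Δ ^ (-z)` extends to a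
trace-class operator on `H` whenever `X` has order at most `q` and `Re z > (q + d) / r`. -/
def IsAnalyticDimension (D : S.DiffOpAlgebra) (d : ℝ) : Prop :=
  IsLeast {d : ℝ | 0 ≤ d ∧ ∀ (q : ℕ) (X : Module.End ℂ S.smooth), X ∈ D.filt q →
    ∀ z : ℂ, (q + d) / D.order < z.re → S.ExtendsToTraceClass (X * S.cpow (-z))} d

/-- The analytic continuation property: all zeta functions of elements of the algebra extend
meromorphically to `ℂ`. -/
def HasAnalyticContinuation (D : S.DiffOpAlgebra) : Prop :=
  ∀ (q : ℕ) (X : Module.End ℂ S.smooth), X ∈ D.filt q → ∃ F, S.IsZetaContinuation D.order X F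

end DiffOpAlgebra

/-- `T : H^∞ → H^∞` has pseudodifferential order `m`, relative to the order `r` of `Δ` and the
analytic dimension `d`: for every `s ≥ 0` it extends to a bounded operator `H ^ (m + s) → H ^ s`
(equivalently, as `H^∞` is dense, it is bounded on `H^∞` for these norms), and if `m < -d`, then it
is of trace class. -/
def HasOrder (S : PositiveOperator H) (r d m : ℝ) (T : Module.End ℂ S.smooth) : Prop :=
  (∀ s : ℝ, 0 ≤ s → ∃ C : ℝ, ∀ v : S.smooth,
    S.sobolevNorm r s (T v) ≤ C * S.sobolevNorm r (m + s) v) ∧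
  (m < -d → S.ExtendsToTraceClass T)

/-- An algebra of abstract pseudodifferential operators, with order `r` of `Δ` and analytic
dimension `d`: an `ℝ`-filtered algebra of operators on `H^∞`, not necessarily unital. -/
structure PsiDOAlgebra (S : PositiveOperator H) (r d : ℝ) where
  filt : ℝ → Submodule ℂ (Module.End ℂ S.smooth)
  mono : Monotone filt
  mul_mem : ∀ (m n : ℝ) (P Q : Module.End ℂ S.smooth),
    P ∈ filt m → Q ∈ filt n → P * Q ∈ filt (m + n)
  hasOrder : ∀ (m : ℝ) (P : Module.End ℂ S.smooth), P ∈ filt m → S.HasOrder r d m P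
  cpow_mul_mem : ∀ (m : ℝ) (z : ℂ) (P : Module.End ℂ S.smooth), P ∈ filt m →
    S.cpow (z / r) * P ∈ filt (z.re + m)
  mul_cpow_mem : ∀ (m : ℝ) (z : ℂ) (P : Module.End ℂ S.smooth), P ∈ filt m →
    P * S.cpow (z / r) ∈ filt (z.re + m)
  comm_mem : ∀ (m : ℝ) (z : ℂ) (P : Module.End ℂ S.smooth), P ∈ filt m →
    S.cpow (z / r) * P - P * S.cpow (z / r) ∈ filt (z.re + m - 1)
  zeta_holomorphic : ∀ (m : ℝ) (P : Module.End ℂ S.smooth), P ∈ filt m →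
    DifferentiableOn ℂ (S.zeta r P) {z : ℂ | m + d < z.re}
  zeta_meromorphic : ∀ (m : ℝ) (P : Module.End ℂ S.smooth), P ∈ filt m →
    ∃ F, S.IsZetaContinuation r P F

namespace PsiDOAlgebra

variable {S : PositiveOperator H} {r d : ℝ}

/-- The algebra `Ψ = ⋃ m, Ψ ^ m`. -/
def algebra (Ψ : S.PsiDOAlgebra r d) : NonUnitalSubalgebra ℂ (Module.End ℂ S.smooth) where
  carrier := {P | ∃ m : ℝ, P ∈ Ψ.filt m}
  add_mem' := by
    rintro P Q ⟨m, hm⟩ ⟨n, hn⟩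
    exact ⟨max m n, (Ψ.filt _).add_mem (Ψ.mono (le_max_left m n) hm)
      (Ψ.mono (le_max_right m n) hn)⟩
  zero_mem' := ⟨0, (Ψ.filt 0).zero_mem⟩
  mul_mem' := by
    rintro P Q ⟨m, hm⟩ ⟨n, hn⟩
    exact ⟨m + n, Ψ.mul_mem m n P Q hm hn⟩
  smul_mem' := by
    rintro c P ⟨m, hm⟩
    exact ⟨m, (Ψ.filt m).smul_mem c hm⟩

/-- The zeta function of the algebra has a pole of order `p` at `0`: the zeta functions of the
elements of the algebra have at `0` at most a pole of order `p`, and order `p` occurs. -/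
def HasPoleOfOrderAtZero (Ψ : S.PsiDOAlgebra r d) (p : ℕ) : Prop :=
  (∀ P ∈ Ψ.algebra, ∀ F, S.IsZetaContinuation r P F →
    ((-(p : ℤ) : ℤ) : WithTop ℤ) ≤ meromorphicOrderAt F 0) ∧
  ∃ P ∈ Ψ.algebra, ∃ F, S.IsZetaContinuation r P F ∧
    meromorphicOrderAt F 0 = ((-(p : ℤ) : ℤ) : WithTop ℤ)

end PsiDOAlgebra

end PositiveOperator

end AbstractPDO

-- Since `ζ_P` has at most a pole of order `p` at `0`, the residue of `z^(p-1) ζ_P(z)` is the limit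
-- of `z^p ζ_P(z)`. Linearity is then immediate, and what must be shown is that this limit is the
-- same for `PQ` and `QP`.
--
-- Take an eigenbasis of `Δ` with eigenvalues `λ_i`. For `Re z` large, both `ζ_{PQ}(z)` and
-- `ζ_{QP}(z)` are absolutely convergent double series with the same coefficients `P_{ji} Q_{ij}`;
-- only the weight differs, `λ_j^(-z/r)` against `λ_i^(-z/r)`. Write `λ_i^(-w) = λ_j^(-w) y^(-w)`
-- with `y = λ_i / λ_j`, `w = z/r`, and expand `y^(-w)` at `y = 1`. As `(y - 1)^k Q_{ij}` is a
-- matrix coefficient of `ad(Δ)^k(Q) Δ^(-k)`, of order `k` less than `Q`, this gives `ζ_{QP}(z) =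
-- ∑_{k<N} binom(-z/r, k) ζ_{P ad(Δ)^k(Q) Δ^(-k)}(z) + h_N(z)`.
--
-- By `norm_negBinomRem_le` the Taylor remainder carries a factor `|y - 1|^N`, which is absorbed
-- into an operator of order `n - N`. Hence `h_N` is a locally uniform limit on any prescribed disc
-- once `N` is large (`differentiableOn_tsum_remTerm`), and the identity theorem carries the formula
-- to a neighbourhood of `0` (`exists_zeta_expansion`). After multiplication by `z^p`, the terms
-- with `k ≥ 1` vanish in the limit because their binomial coefficients vanish at `z = 0`, and `z^p
-- h_N` vanishes because `p ≥ 1`. Only the term `k = 0` remains, which is `ζ_{PQ}`.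

universe u

/-! ### Meromorphic continuation, poles and residues -/

namespace AbstractPDO

/-- Two meromorphic functions on a preconnected set that agree near one point, except possibly at
that point, agree in this sense near every point. -/
theorem meromorphicOn_eventuallyEq_of_isPreconnected {F G : ℂ → ℂ} {U : Set ℂ}
    (hF : MeromorphicOn F U) (hG : MeromorphicOn G U) (hU : IsPreconnected U) {x y : ℂ}
    (hx : x ∈ U) (hy : y ∈ U) (h : F =ᶠ[𝓝[≠] x] G) : F =ᶠ[𝓝[≠] y] G := by
  have hm : MeromorphicOn (F - G) U := fun z hz => (hF z hz).sub (hG z hz)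
  have h1 : meromorphicOrderAt (F - G) x = ⊤ := by
    rw [meromorphicOrderAt_eq_top_iff]
    filter_upwards [h] with z hz
    simp [hz]
  have h2 : meromorphicOrderAt (F - G) y = ⊤ := by
    by_contra hne
    exact hm.meromorphicOrderAt_ne_top_of_isPreconnected hU hy hx hne h1
  rw [meromorphicOrderAt_eq_top_iff] at h2
  filter_upwards [h2] with z hz
  simpa [sub_eq_zero] using hz

theorem exists_tendsto_pow_mul {F : ℂ → ℂ} {p : ℕ} (hF : MeromorphicAt F 0)
    (hp : ((-(p : ℤ) : ℤ) : WithTop ℤ) ≤ meromorphicOrderAt F 0) :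
    ∃ a, Tendsto (fun z => z ^ p * F z) (𝓝[≠] 0) (𝓝 a) := by
  have hid : MeromorphicAt (fun z : ℂ => z ^ p) 0 := (analyticAt_id.pow p).meromorphicAt
  apply tendsto_nhds_of_meromorphicOrderAt_nonneg (hid.mul hF)
  rw [meromorphicOrderAt_mul hid hF]
  have : meromorphicOrderAt (fun z : ℂ => z ^ p) 0 = ((p : ℤ) : WithTop ℤ) := by
    have := meromorphicOrderAt_pow_id_sub_const (𝕜 := ℂ) (x := 0) (n := p)
    simpa [Pi.pow_def] using! this
  rw [this]
  cases h : meromorphicOrderAt F 0 with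
  | top => simp
  | coe n =>
    rw [h] at hp
    norm_cast at hp ⊢
    omega

/-- Filling the removable singularity of `z^p F` gives an analytic `g` with `g 0 = a`. On small
circles `z^(p-1) F = g / z`, so Cauchy's integral formula evaluates the integral. -/
theorem hasResidueAt_of_tendsto {F : ℂ → ℂ} {p : ℕ} (hp : 1 ≤ p) {a : ℂ}
    (hF : MeromorphicAt F 0) (ha : Tendsto (fun z => z ^ p * F z) (𝓝[≠] 0) (𝓝 a)) :
    HasResidueAt (fun z => z ^ (p - 1) * F z) 0 a := by
  classical
  set g : ℂ → ℂ := Function.update (fun z => z ^ p * F z) 0 a with hg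
  have hid : MeromorphicAt (fun z : ℂ => z ^ p) 0 := (analyticAt_id.pow p).meromorphicAt
  have hgm : MeromorphicAt g 0 := (hid.mul hF).update 0 a
  have hgc : ContinuousAt g 0 := continuousAt_update_same.2 ha
  have hga : AnalyticAt ℂ g 0 := hgm.analyticAt hgc
  obtain ⟨ε, hε, hball⟩ := Metric.eventually_nhds_iff_ball.1 hga.eventually_analyticAt
  filter_upwards [Ioo_mem_nhdsGT hε] with ρ hρ
  have hdiff : DifferentiableOn ℂ g (Metric.closedBall 0 ρ) := fun z hz =>
    (hball z (Metric.closedBall_subset_ball hρ.2 hz)).differentiableAt.differentiableWithinAt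
  have heq : Set.EqOn (fun z => z ^ (p - 1) * F z) (fun z => (z - 0)⁻¹ • g z)
      (Metric.sphere 0 ρ) := by
    intro z hz
    have hz0 : z ≠ 0 := by
      rintro rfl
      simp at hz
      exact hρ.1.ne hz
    obtain ⟨q, rfl⟩ : ∃ q, p = q + 1 := ⟨p - 1, by omega⟩
    simp only [hg, Function.update_of_ne hz0, sub_zero, smul_eq_mul, Nat.add_sub_cancel]
    rw [pow_succ']
    field_simp
  constructor
  · have hρ' : |ρ| = ρ := abs_of_pos hρ.1
    rw [circleIntegrable_congr (hρ'.symm ▸ heq)]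
    refine ContinuousOn.circleIntegrable hρ.1.le ?_
    refine ContinuousOn.smul (ContinuousOn.inv₀ (continuousOn_id.sub continuousOn_const) ?_)
      (hdiff.continuousOn.mono Metric.sphere_subset_closedBall)
    intro z hz h
    obtain rfl : z = 0 := by simpa using h
    simp at hz
    exact hρ.1.ne hz
  · rw [circleIntegral.integral_congr hρ.1.le heq,
      hdiff.circleIntegral_sub_inv_smul (Metric.mem_ball_self hρ.1)]
    simp only [hg, Function.update_self, smul_eq_mul]
    rw [inv_mul_cancel_left₀]
    simp [Real.pi_ne_zero, Complex.I_ne_zero]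

namespace PositiveOperator

variable {H : Type*} [NormedAddCommGroup H] [InnerProductSpace ℂ H] [CompleteSpace H]
  {S : PositiveOperator H} {r : ℝ} {P : Module.End ℂ S.smooth} {F G : ℂ → ℂ}

/-- A continuation is only required to match the zeta function on some unspecified half-plane; the
identity theorem spreads the agreement over the whole half-plane where the zeta function is
holomorphic. The neighbourhoods are punctured because values of a meromorphic function at isolated
points are arbitrary. -/
theorem IsZetaContinuation.eventuallyEq_zeta (hF : S.IsZetaContinuation r P F) {c : ℝ}
    (hc : DifferentiableOn ℂ (S.zeta r P) {z : ℂ | c < z.re}) {x : ℂ} (hx : c < x.re) :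
    F =ᶠ[𝓝[≠] x] S.zeta r P := by
  obtain ⟨hF, c', hc'⟩ := hF
  have hopen : ∀ a : ℝ, IsOpen {z : ℂ | a < z.re} := fun a =>
    isOpen_lt continuous_const Complex.continuous_re
  have hx' : max c c' < (((max c c' + 1 : ℝ) : ℂ)).re := by
    rw [Complex.ofReal_re]; exact lt_add_one _
  refine meromorphicOn_eventuallyEq_of_isPreconnected (U := {z : ℂ | c < z.re})
    (x := ((max c c' + 1 : ℝ) : ℂ)) (fun z _ => hF z)
    (hc.analyticOnNhd (hopen c)).meromorphicOn (convex_halfSpace_re_gt c).isPreconnected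
    ((le_max_left _ _).trans_lt hx') hx ?_
  filter_upwards [nhdsWithin_le_nhds ((hopen c').mem_nhds ((le_max_right _ _).trans_lt hx'))]
    with z hz using hc' z hz

theorem IsZetaContinuation.eventuallyEq (hF : S.IsZetaContinuation r P F)
    (hG : S.IsZetaContinuation r P G) (y : ℂ) : F =ᶠ[𝓝[≠] y] G := by
  obtain ⟨hF, c, hc⟩ := hF
  obtain ⟨hG, c', hc'⟩ := hG
  have hopen : IsOpen {z : ℂ | max c c' < z.re} := isOpen_lt continuous_const Complex.continuous_re
  refine meromorphicOn_eventuallyEq_of_isPreconnected (U := Set.univ)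
    (x := ((max c c' + 1 : ℝ) : ℂ)) (fun z _ => hF z) (fun z _ => hG z) isPreconnected_univ
    trivial trivial ?_
  filter_upwards [nhdsWithin_le_nhds (hopen.mem_nhds (by
    rw [Set.mem_ofPred_eq, Complex.ofReal_re]; exact lt_add_one _))] with z hz
  have hz := max_lt_iff.1 hz
  rw [hc z hz.1, hc' z hz.2]

end PositiveOperator

end AbstractPDO

/-! ### Taylor expansion of `y ^ (-w)` at `y = 1` -/

namespace AbstractPDO

/-- The `k`-th binomial coefficient of `y ↦ y ^ (-w)` at `y = 1`. -/
noncomputable def negBinom (w : ℂ) (k : ℕ) : ℂ :=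
  (∏ j ∈ Finset.range k, (-(w + j))) / k.factorial

theorem negBinom_zero (w : ℂ) : negBinom w 0 = 1 := by simp [negBinom]

theorem negBinom_at_zero {k : ℕ} (hk : 1 ≤ k) : negBinom 0 k = 0 := by
  obtain ⟨j, rfl⟩ : ∃ j, k = j + 1 := ⟨k - 1, by omega⟩
  simp [negBinom, Finset.prod_range_succ']

theorem differentiable_negBinom (k : ℕ) : Differentiable ℂ (fun w => negBinom w k) := by
  unfold negBinom
  refine Differentiable.div_const ?_ _
  exact Differentiable.fun_finsetProd fun i _ => by fun_prop

/-- Coefficientwise form of the derivative rule for `y ^ (-w)`. -/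
theorem succ_mul_negBinom_succ (w : ℂ) (k : ℕ) :
    ((k : ℂ) + 1) * negBinom w (k + 1) = -w * negBinom (w + 1) k := by
  have h : (k.factorial : ℂ) ≠ 0 := by exact_mod_cast k.factorial_ne_zero
  have h1 : (k : ℂ) + 1 ≠ 0 := by exact_mod_cast k.succ_ne_zero
  simp only [negBinom, Finset.prod_range_succ', Nat.factorial_succ]
  have : ∀ j : ℕ, (w + ((j + 1 : ℕ) : ℂ)) = w + 1 + j := fun j => by push_cast; ring
  simp only [this]
  push_cast
  field_simp
  ring

/-- The remainder of the binomial expansion of `y ^ (-w)` at `y = 1`. -/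
noncomputable def negBinomRem (N : ℕ) (w : ℂ) (y : ℝ) : ℂ :=
  (y : ℂ) ^ (-w) - ∑ k ∈ Finset.range N, negBinom w k * ((y : ℂ) - 1) ^ k

theorem negBinomRem_succ_one (N : ℕ) (w : ℂ) : negBinomRem (N + 1) w 1 = 0 := by
  simp [negBinomRem, Finset.sum_range_succ', negBinom_zero]

/-- Differentiation lowers the order of the remainder by one and shifts `w` to `w + 1`; this drives
the induction for the remainder estimate. -/
theorem hasDerivAt_negBinomRem_succ (N : ℕ) (w : ℂ) {y : ℝ} (hy : 0 < y) :
    HasDerivAt (negBinomRem (N + 1) w) (-w * negBinomRem N (w + 1) y) y := by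
  have h1 : HasDerivAt (fun z : ℂ => z ^ (-w)) (-w * (y : ℂ) ^ (-w - 1)) (y : ℂ) :=
    (hasDerivAt_id _).cpow_const (Or.inl (by simpa using hy)) |>.congr_deriv (by simp)
  have h2 : ∀ k ∈ Finset.range (N + 1), HasDerivAt
      (fun z : ℂ => negBinom w k * (z - 1) ^ k)
      (negBinom w k * (k * ((y : ℂ) - 1) ^ (k - 1))) (y : ℂ) := by
    intro k _
    refine HasDerivAt.const_mul _ ?_
    simpa using! ((hasDerivAt_id (y : ℂ)).sub_const 1).fun_pow k
  have h3 := (h1.sub (HasDerivAt.fun_sum h2)).comp_ofReal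
  refine h3.congr_deriv ?_
  rw [Finset.sum_range_succ']
  simp only [negBinomRem, mul_sub, Finset.mul_sum, Nat.add_sub_cancel]
  congr 1
  · congr 2; ring
  · simp only [Nat.cast_zero, zero_mul, mul_zero, add_zero]
    refine Finset.sum_congr rfl fun k _ => ?_
    rw [← mul_assoc (-w), ← succ_mul_negBinom_succ]
    push_cast
    ring

theorem rpow_le_max_one {t y : ℝ} (hy : 0 < y) (ht : t ∈ Set.uIcc 1 y) (a : ℝ) :
    t ^ a ≤ max 1 (y ^ a) := by
  have ht0 : 0 < t := lt_of_lt_of_le (lt_min one_pos hy) ht.1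
  rcases le_total 0 a with ha | ha
  · rcases le_total 1 y with h | h
    · rw [Set.uIcc_of_le h] at ht
      exact le_max_of_le_right (Real.rpow_le_rpow ht0.le ht.2 ha)
    · rw [Set.uIcc_of_ge h] at ht
      exact le_max_of_le_left (Real.rpow_le_one ht0.le ht.2 ha)
  · rcases le_total 1 y with h | h
    · rw [Set.uIcc_of_le h] at ht
      exact le_max_of_le_left (Real.rpow_le_one_of_one_le_of_nonpos ht.1 ha)
    · rw [Set.uIcc_of_ge h] at ht
      exact le_max_of_le_right (Real.rpow_le_rpow_of_nonpos hy ht.1 ha)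

/-- Induction on `N`: the remainder vanishes at `1`, so the mean value inequality bounds it by `|y -
1|` times a bound for its derivative between `1` and `y`. The maximum treats `y ≤ 1` and `y ≥ 1` at
once, since powers of `t` are monotone and hence controlled by the two endpoints. -/
theorem norm_negBinomRem_le (N : ℕ) : ∀ (w : ℂ) (y : ℝ), 0 < y →
    ‖negBinomRem N w y‖ ≤
      (∏ k ∈ Finset.range N, ‖w + k‖) * (|y - 1| ^ N * max 1 (y ^ (-w.re - N))) := by
  induction N with
  | zero =>
    intro w y hy
    simp [negBinomRem, Complex.norm_cpow_eq_rpow_re_of_pos hy]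
  | succ N ih =>
    intro w y hy
    have hpos : ∀ t ∈ Set.uIcc 1 y, 0 < t := fun t ht =>
      lt_of_lt_of_le (lt_min one_pos hy) ht.1
    set C : ℝ := ‖w‖ * ((∏ k ∈ Finset.range N, ‖w + 1 + k‖) *
      (|y - 1| ^ N * max 1 (y ^ (-w.re - (N + 1 : ℕ))))) with hC
    have hbound : ∀ t ∈ Set.uIcc 1 y, ‖-w * negBinomRem N (w + 1) t‖ ≤ C := by
      intro t ht
      rw [norm_mul, norm_neg]
      refine mul_le_mul_of_nonneg_left ((ih (w + 1) t (hpos t ht)).trans ?_) (norm_nonneg _)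
      refine mul_le_mul_of_nonneg_left ?_ (Finset.prod_nonneg fun _ _ => norm_nonneg _)
      refine mul_le_mul ?_ ?_ (by positivity) (by positivity)
      · refine pow_le_pow_left₀ (abs_nonneg _) ?_ _
        exact Set.abs_sub_left_of_mem_uIcc ht
      · refine max_le (le_max_left _ _) ?_
        have : -(w + 1).re - (N : ℝ) = -w.re - ((N + 1 : ℕ) : ℝ) := by
          simp; ring
        rw [this]
        exact rpow_le_max_one hy ht _
    have hmv := (convex_uIcc 1 y).norm_image_sub_le_of_norm_hasDerivWithin_le
      (fun t ht => (hasDerivAt_negBinomRem_succ N w (hpos t ht)).hasDerivWithinAt)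
      hbound Set.left_mem_uIcc Set.right_mem_uIcc
    rw [negBinomRem_succ_one, sub_zero] at hmv
    refine hmv.trans (le_of_eq ?_)
    rw [hC, Finset.prod_range_succ', Real.norm_eq_abs]
    have : ∀ j : ℕ, (w + ((j + 1 : ℕ) : ℂ)) = w + 1 + j := fun j => by push_cast; ring
    simp only [this, Nat.cast_zero, add_zero]
    ring

theorem differentiable_negBinomRem (N : ℕ) {y : ℝ} (hy : 0 < y) :
    Differentiable ℂ (fun w => negBinomRem N w y) := by
  unfold negBinomRem
  refine Differentiable.sub ?_ (Differentiable.fun_sum fun k _ =>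
    (differentiable_negBinom k).mul_const _)
  refine Differentiable.const_cpow (by fun_prop) (Or.inl ?_)
  exact_mod_cast hy.ne'

end AbstractPDO

/-! ### Traces and double series of trace-class operators -/

namespace AbstractPDO

section TraceClass

variable {H : Type*} [NormedAddCommGroup H] [InnerProductSpace ℂ H]

/-- Cauchy–Schwarz for the coefficients in an orthonormal family. -/
theorem tsum_enorm_inner_mul_inner_le {ι : Type*} {b : ι → H} (hb : Orthonormal ℂ b) (x y : H) :
    ∑' i, ‖⟪x, b i⟫_ℂ‖ₑ * ‖⟪b i, y⟫_ℂ‖ₑ ≤ ‖x‖ₑ * ‖y‖ₑ := by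
  rw [ENNReal.tsum_eq_iSup_sum]
  refine iSup_le fun s => ?_
  have h1 : ∑ i ∈ s, ‖⟪x, b i⟫_ℂ‖ * ‖⟪b i, y⟫_ℂ‖ ≤ ‖x‖ * ‖y‖ := by
    refine (Real.sum_mul_le_sqrt_mul_sqrt _ _ _).trans ?_
    refine mul_le_mul (Real.sqrt_le_iff.2 ⟨norm_nonneg _, ?_⟩)
      (Real.sqrt_le_iff.2 ⟨norm_nonneg _, hb.sum_inner_products_le y⟩)
      (Real.sqrt_nonneg _) (norm_nonneg _)
    simpa only [norm_inner_symm x] using hb.sum_inner_products_le (s := s) x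
  calc ∑ i ∈ s, ‖⟪x, b i⟫_ℂ‖ₑ * ‖⟪b i, y⟫_ℂ‖ₑ
      = ENNReal.ofReal (∑ i ∈ s, ‖⟪x, b i⟫_ℂ‖ * ‖⟪b i, y⟫_ℂ‖) := by
        rw [ENNReal.ofReal_sum_of_nonneg fun _ _ => by positivity]
        refine Finset.sum_congr rfl fun i _ => ?_
        rw [ENNReal.ofReal_mul (norm_nonneg _), ofReal_norm, ofReal_norm]
    _ ≤ ENNReal.ofReal (‖x‖ * ‖y‖) := ENNReal.ofReal_le_ofReal h1
    _ = ‖x‖ₑ * ‖y‖ₑ := by rw [ENNReal.ofReal_mul (norm_nonneg _), ofReal_norm, ofReal_norm]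

theorem tsum_enorm_mul_enorm_ne_top {E : Type*} [NormedAddCommGroup E] {x y : ℕ → E} (h : Summable fun n => ‖x n‖ * ‖y n‖) :
    ∑' n, ‖x n‖ₑ * ‖y n‖ₑ ≠ ⊤ := by
  have h1 : ∑' n, ‖‖x n‖ * ‖y n‖‖ₑ ≠ ⊤ :=
    tsum_enorm_ne_top_iff_summable_norm.2 (by simpa using h)
  simpa [enorm_mul] using h1

theorem hasSum_inner_apply {A : H →L[ℂ] H} {x y : ℕ → H}
    (hA : ∀ v : H, HasSum (fun n => ⟪x n, v⟫_ℂ • y n) (A v)) (u v : H) :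
    HasSum (fun n => ⟪x n, v⟫_ℂ * ⟪u, y n⟫_ℂ) ⟪u, A v⟫_ℂ := by
  simpa [inner_smul_right] using (hA v).mapL (innerSL ℂ u)

/-- The diagonal coefficients of a trace-class operator in any Hilbert basis have the same sum. -/
theorem hasSum_inner_diag [CompleteSpace H] {ι : Type*} (b : HilbertBasis ι ℂ H) {A : H →L[ℂ] H}
    {x y : ℕ → H} (hs : Summable fun n => ‖x n‖ * ‖y n‖)
    (hA : ∀ v : H, HasSum (fun n => ⟪x n, v⟫_ℂ • y n) (A v)) :
    HasSum (fun i => ⟪b i, A (b i)⟫_ℂ) (∑' n, ⟪x n, y n⟫_ℂ) := by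
  have hsum : Summable fun q : ι × ℕ => ⟪x q.2, b q.1⟫_ℂ * ⟪b q.1, y q.2⟫_ℂ := by
    -- Absolute summability over pairs, from Cauchy–Schwarz in the basis index, is what permits
    -- exchanging the two summations.
    refine Summable.of_enorm ?_
    rw [ENNReal.tsum_prod', ENNReal.tsum_comm]
    refine ne_top_of_le_ne_top (tsum_enorm_mul_enorm_ne_top hs) (ENNReal.tsum_le_tsum fun n => ?_)
    simpa only [enorm_mul] using tsum_enorm_inner_mul_inner_le b.orthonormal (x n) (y n)
  have h1 := hsum.hasSum.prod_fiberwise fun i => hasSum_inner_apply hA (b i) (b i)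
  have h2 : ∑' q : ι × ℕ, ⟪x q.2, b q.1⟫_ℂ * ⟪b q.1, y q.2⟫_ℂ = ∑' n, ⟪x n, y n⟫_ℂ := by
    have hsum' : Summable fun q : ℕ × ι => ⟪x q.1, b q.2⟫_ℂ * ⟪b q.2, y q.1⟫_ℂ := hsum.prod_symm
    rw [← (Equiv.prodComm ℕ ι).tsum_eq]
    refine hsum'.tsum_prod.trans ?_
    exact tsum_congr fun n => b.tsum_inner_mul_inner (x n) (y n)
  rwa [h2] at h1

theorem IsTraceClass.hasSum_trace [CompleteSpace H] {A : H →L[ℂ] H} (hA : IsTraceClass A)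
    {ι : Type*} (b : HilbertBasis ι ℂ H) : HasSum (fun i => ⟪b i, A (b i)⟫_ℂ) (trace A) := by
  obtain ⟨x, y, hs, hA⟩ := hA
  have h1 : trace A = ∑' n, ⟪x n, y n⟫_ℂ := (hasSum_inner_diag _ hs hA).tsum_eq
  rw [h1]
  exact hasSum_inner_diag b hs hA

/-- Expand both operators into rank-one terms and apply Cauchy–Schwarz separately to the two basis
indices. -/
theorem IsTraceClass.summable_mul [CompleteSpace H] {A B : H →L[ℂ] H} (hA : IsTraceClass A)
    (hB : IsTraceClass B) {ι : Type*} (b : HilbertBasis ι ℂ H) :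
    Summable fun q : ι × ι => ‖⟪b q.2, A (b q.1)⟫_ℂ‖ * ‖⟪b q.1, B (b q.2)⟫_ℂ‖ := by
  obtain ⟨x, y, hs, hA⟩ := hA
  obtain ⟨x', y', hs', hB⟩ := hB
  have key : ∑' q : ι × ι, ‖⟪b q.2, A (b q.1)⟫_ℂ * ⟪b q.1, B (b q.2)⟫_ℂ‖ₑ ≠ ⊤ := by
    have hfin := ENNReal.mul_ne_top (tsum_enorm_mul_enorm_ne_top hs)
      (tsum_enorm_mul_enorm_ne_top hs')
    refine ne_top_of_le_ne_top hfin ?_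
    have hcoef : ∀ {C : H →L[ℂ] H} {s t : ℕ → H}
        (_ : ∀ v : H, HasSum (fun n => ⟪s n, v⟫_ℂ • t n) (C v)) (u v : H),
        ‖⟪u, C v⟫_ℂ‖ₑ ≤ ∑' n, ‖⟪s n, v⟫_ℂ‖ₑ * ‖⟪u, t n⟫_ℂ‖ₑ := by
      intro C s t h u v
      rw [← (hasSum_inner_apply h u v).tsum_eq]
      exact enorm_tsum_le_tsum_enorm.trans_eq (tsum_congr fun n => enorm_mul _ _)
    calc ∑' q : ι × ι, ‖⟪b q.2, A (b q.1)⟫_ℂ * ⟪b q.1, B (b q.2)⟫_ℂ‖ₑ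
        ≤ ∑' q : ι × ι, (∑' n, ‖⟪x n, b q.1⟫_ℂ‖ₑ * ‖⟪b q.2, y n⟫_ℂ‖ₑ) *
            ∑' m, ‖⟪x' m, b q.2⟫_ℂ‖ₑ * ‖⟪b q.1, y' m⟫_ℂ‖ₑ := by
          refine ENNReal.tsum_le_tsum fun q => ?_
          rw [enorm_mul]
          exact mul_le_mul' (hcoef hA _ _) (hcoef hB _ _)
      -- The factors are regrouped by basis index: `i` couples `x n` with `y' m`, and `j` couples
      -- `x' m` with `y n`.
      _ = ∑' n, ∑' m, (∑' i, ‖⟪x n, b i⟫_ℂ‖ₑ * ‖⟪b i, y' m⟫_ℂ‖ₑ) *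
            ∑' j, ‖⟪x' m, b j⟫_ℂ‖ₑ * ‖⟪b j, y n⟫_ℂ‖ₑ := by
          simp_rw [← ENNReal.tsum_mul_right, ← ENNReal.tsum_mul_left]
          rw [ENNReal.tsum_comm]
          refine tsum_congr fun n => ?_
          rw [ENNReal.tsum_comm]
          refine tsum_congr fun m => ?_
          rw [ENNReal.tsum_prod']
          refine tsum_congr fun i => tsum_congr fun j => ?_
          ring
      _ ≤ ∑' n, ∑' m, (‖x n‖ₑ * ‖y' m‖ₑ) * (‖x' m‖ₑ * ‖y n‖ₑ) :=
          ENNReal.tsum_le_tsum fun n => ENNReal.tsum_le_tsum fun m =>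
            mul_le_mul' (tsum_enorm_inner_mul_inner_le b.orthonormal _ _)
              (tsum_enorm_inner_mul_inner_le b.orthonormal _ _)
      _ = (∑' n, ‖x n‖ₑ * ‖y n‖ₑ) * ∑' m, ‖x' m‖ₑ * ‖y' m‖ₑ := by
          simp_rw [← ENNReal.tsum_mul_right, ← ENNReal.tsum_mul_left]
          exact tsum_congr fun n => tsum_congr fun m => by ring
  simpa only [norm_mul] using tsum_enorm_ne_top_iff_summable_norm.1 key

end TraceClass

end AbstractPDO

/-! ### An eigenbasis of `Δ` -/

namespace AbstractPDO
namespace PositiveOperator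

variable {H : Type*} [NormedAddCommGroup H] [InnerProductSpace ℂ H] [CompleteSpace H]

/-- An eigenvalue of the inverse is nonzero by injectivity and real by symmetry, so `e` is a
multiple of `R e` and lies in the domain. -/
theorem isEigen_of_inverse (S : PositiveOperator H) (R : H →L[ℂ] H)
    (hR : ∀ v : H, ∃ h : R v ∈ S.op.domain, S.op ⟨R v, h⟩ = v) {ν : ℂ} {e : H}
    (he : R e = ν • e) (he0 : e ≠ 0) : ∃ μ : ℝ, S.IsEigen μ e := by
  obtain ⟨h, hRe⟩ := hR e
  have hν : ν ≠ 0 := by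
    rintro rfl
    apply he0
    rw [← hRe]
    have : (⟨R e, h⟩ : S.op.domain) = 0 := by
      apply Subtype.ext; simpa using he
    rw [this, LinearPMap.map_zero]
  have hconj : (starRingEnd ℂ) ν = ν := (S.inverse_symm R hR).conj_eigenvalue_eq_self
    (Module.End.hasEigenvalue_of_hasEigenvector (Module.End.hasEigenvector_iff.2
      ⟨Module.End.mem_eigenspace_iff.2 he, he0⟩))
  obtain ⟨t, rfl⟩ := Complex.conj_eq_iff_real.1 hconj
  have hmem : e ∈ S.op.domain := by
    have : e = (t : ℂ)⁻¹ • R e := by rw [he, smul_smul, inv_mul_cancel₀ hν, one_smul]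
    rw [this]
    exact S.op.domain.smul_mem _ h
  refine ⟨t⁻¹, hmem, ?_⟩
  have h2 : (⟨R e, h⟩ : S.op.domain) = (t : ℂ) • ⟨e, hmem⟩ := by
    apply Subtype.ext; simpa using he
  rw [h2, LinearPMap.map_smul] at hRe
  calc S.op ⟨e, hmem⟩ = (t : ℂ)⁻¹ • ((t : ℂ) • S.op ⟨e, hmem⟩) := by
        rw [smul_smul, inv_mul_cancel₀ hν, one_smul]
    _ = ((t⁻¹ : ℝ) : ℂ) • e := by rw [hRe]; push_cast; rfl

theorem IsEigen.mem_smooth {S : PositiveOperator H} {μ : ℝ} {e : H} (he : S.IsEigen μ e) :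
    e ∈ S.smooth := by
  rw [PositiveOperator.mem_smooth]
  intro k
  induction k with
  | zero => simp [domPow]
  | succ k ih =>
    obtain ⟨h, h1⟩ := he
    exact (mem_domPow_succ _ _ _).2 ⟨h, by rw [h1]; exact Submodule.smul_mem _ _ ih⟩

/-- Parseval in `G`, applied to the orthogonal projection of `u`. -/
theorem inner_eq_zero_of_hilbertBasis {E : Type*} [NormedAddCommGroup E]
    [InnerProductSpace ℂ E] {G : Submodule ℂ E} [CompleteSpace G] {κ : Type*}
    (c : HilbertBasis κ ℂ G) {u : E} (hu : ∀ i, ⟪(c i : E), u⟫_ℂ = 0) {e : E} (he : e ∈ G) :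
    ⟪e, u⟫_ℂ = 0 := by
  have hz : ∀ i, ⟪c i, G.orthogonalProjectionOnto u⟫_ℂ = 0 := by
    intro i
    rw [Submodule.inner_orthogonalProjectionOnto_eq_of_mem_left]
    exact hu i
  have h1 := c.tsum_inner_mul_inner ⟨e, he⟩ (G.orthogonalProjectionOnto u)
  simp only [hz, mul_zero, tsum_zero] at h1
  rw [Submodule.inner_orthogonalProjectionOnto_eq_of_mem_left] at h1
  exact h1.symm

/-- The Hilbert space has a Hilbert basis of eigenvectors of `Δ`, with positive eigenvalues. -/
theorem exists_eigenbasis {H : Type u} [NormedAddCommGroup H] [InnerProductSpace ℂ H]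
    [CompleteSpace H] (S : PositiveOperator H) :
    ∃ (ι : Type u) (b : HilbertBasis ι ℂ H) (l : ι → ℝ), ∀ i, 0 < l i ∧ S.IsEigen (l i) (b i) := by
  classical
  obtain ⟨R, hRc, hR, hR'⟩ := S.compact_inverse
  have hsym := S.inverse_symm R hR
  let G : ℂ → Submodule ℂ H := fun ν => Module.End.eigenspace (R : H →ₗ[ℂ] H) ν
  have hG : ∀ ν e, e ∈ G ν ↔ R e = ν • e := fun ν e => by simp [G]
  have hclosed : ∀ ν, IsClosed (G ν : Set H) := by
    intro ν
    have : (G ν : Set H) = {e | R e = ν • e} := by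
      ext e; simp [G]
    rw [this]
    exact isClosed_eq R.continuous (continuous_const_smul ν)
  have : ∀ ν, CompleteSpace (G ν) := fun ν => (hclosed ν).completeSpace_coe
  -- A Hilbert basis is chosen in each eigenspace of the compact inverse; their union is
  -- orthonormal, and total by `eigen_total`.
  choose w c hc using fun ν => exists_hilbertBasis ℂ (G ν)
  let v : (Σ ν, w ν) → H := fun q => (c q.1 q.2 : H)
  have hv : Orthonormal ℂ v :=
    hsym.orthogonalFamily_eigenspaces.orthonormal_sigma_orthonormal fun ν => (c ν).orthonormal
  have hbot : (Submodule.span ℂ (Set.range v))ᗮ = ⊥ := by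
    rw [Submodule.eq_bot_iff]
    intro u hu
    refine S.eigen_total u fun μ e he => ?_
    by_cases he0 : e = 0
    · simp [he0]
    have heG : e ∈ G ((μ : ℂ)⁻¹) := (hG _ _).2 (S.eigen_inverse R hR' he he0).2
    refine inner_eq_zero_of_hilbertBasis (c _) (fun i => ?_) heG
    exact (Submodule.mem_orthogonal _ _).1 hu _ (Submodule.subset_span ⟨⟨_, i⟩, rfl⟩)
  have heig : ∀ q, ∃ μ : ℝ, S.IsEigen μ (v q) := fun q =>
    S.isEigen_of_inverse R hR ((hG _ _).1 (c q.1 q.2).2) (hv.ne_zero q)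
  choose l hl using heig
  refine ⟨_, HilbertBasis.mkOfOrthogonalEqBot hv hbot, l, fun q => ?_⟩
  rw [HilbertBasis.coe_mkOfOrthogonalEqBot]
  exact ⟨(S.eigen_inverse R hR' (hl q) (hv.ne_zero q)).1, hl q⟩

end PositiveOperator
end AbstractPDO

/-! ### Matrix coefficients in the eigenbasis -/

namespace AbstractPDO
namespace PositiveOperator

/-- A Hilbert basis of eigenvectors of `Δ`, with positive eigenvalues. -/
structure EigenBasis {H : Type*} [NormedAddCommGroup H] [InnerProductSpace ℂ H] [CompleteSpace H]
    (S : PositiveOperator H) (ι : Type*) where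
  basis : HilbertBasis ι ℂ H
  eigenvalue : ι → ℝ
  pos : ∀ i, 0 < eigenvalue i
  isEigen : ∀ i, S.IsEigen (eigenvalue i) (basis i)

theorem nonempty_eigenBasis {H : Type u} [NormedAddCommGroup H] [InnerProductSpace ℂ H]
    [CompleteSpace H] (S : PositiveOperator H) : ∃ ι : Type u, Nonempty (S.EigenBasis ι) := by
  obtain ⟨ι, b, l, h⟩ := S.exists_eigenbasis
  exact ⟨ι, ⟨⟨b, l, fun i => (h i).1, fun i => (h i).2⟩⟩⟩

namespace EigenBasis

variable {H : Type*} [NormedAddCommGroup H] [InnerProductSpace ℂ H] [CompleteSpace H]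
  {S : PositiveOperator H} {ι : Type*} (B : S.EigenBasis ι)

theorem eigenvalue_ne_zero (i : ι) : (B.eigenvalue i : ℂ) ≠ 0 := by
  exact_mod_cast (B.pos i).ne'

/-- The basis vectors as elements of `H^∞`. -/
noncomputable def vec (i : ι) : S.smooth := ⟨B.basis i, (B.isEigen i).mem_smooth⟩

/-- The matrix coefficients of an operator on `H^∞`. -/
noncomputable def coef (T : Module.End ℂ S.smooth) (i j : ι) : ℂ :=
  ⟪B.basis i, (T (B.vec j) : H)⟫_ℂ

include B in
theorem ext_inner {u v : H} (h : ∀ i, ⟪B.basis i, u⟫_ℂ = ⟪B.basis i, v⟫_ℂ) : u = v := by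
  apply B.basis.repr.injective
  ext i
  rw [B.basis.repr_apply_apply, B.basis.repr_apply_apply, h]

theorem inner_cpow (w : ℂ) (v : S.smooth) (i : ι) :
    ⟪B.basis i, (S.cpow w v : H)⟫_ℂ = (B.eigenvalue i : ℂ) ^ w * ⟪B.basis i, (v : H)⟫_ℂ :=
  S.cpow_spec w v _ _ (B.isEigen i)

theorem cpow_vec (w : ℂ) (j : ι) : S.cpow w (B.vec j) = (B.eigenvalue j : ℂ) ^ w • B.vec j := by
  classical
  apply Subtype.ext
  refine B.ext_inner fun i => ?_
  rw [B.inner_cpow, Submodule.coe_smul, inner_smul_right]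
  by_cases h : i = j
  · rw [h]
  · have : ⟪B.basis i, (B.vec j : H)⟫_ℂ = 0 := B.basis.orthonormal.2 h
    rw [this, mul_zero, mul_zero]

theorem coef_cpow_mul (w : ℂ) (T : Module.End ℂ S.smooth) (i j : ι) :
    B.coef (S.cpow w * T) i j = (B.eigenvalue i : ℂ) ^ w * B.coef T i j :=
  B.inner_cpow w (T (B.vec j)) i

theorem coef_mul_cpow (w : ℂ) (T : Module.End ℂ S.smooth) (i j : ι) :
    B.coef (T * S.cpow w) i j = B.coef T i j * (B.eigenvalue j : ℂ) ^ w := by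
  rw [coef, Module.End.mul_apply, B.cpow_vec, map_smul, Submodule.coe_smul, inner_smul_right,
    mul_comm]
  rfl

theorem coef_sub (T U : Module.End ℂ S.smooth) (i j : ι) :
    B.coef (T - U) i j = B.coef T i j - B.coef U i j := by
  simp [coef]

theorem coef_add (T U : Module.End ℂ S.smooth) (i j : ι) :
    B.coef (T + U) i j = B.coef T i j + B.coef U i j := by
  simp [coef]

theorem coef_smul (c : ℂ) (T : Module.End ℂ S.smooth) (i j : ι) :
    B.coef (c • T) i j = c * B.coef T i j := by
  simp [coef]

include B in
theorem cpow_neg_cpow (w : ℂ) (v : S.smooth) : S.cpow (-w) (S.cpow w v) = v := by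
  apply Subtype.ext
  refine B.ext_inner fun i => ?_
  rw [B.inner_cpow, B.inner_cpow, ← mul_assoc, ← Complex.cpow_add _ _ (B.eigenvalue_ne_zero i)]
  simp

/-- Frees the trace from the choices of extension and Hilbert basis in its definition. -/
theorem hasSum_Tr {T : Module.End ℂ S.smooth} (hT : S.ExtendsToTraceClass T) :
    HasSum (fun i => B.coef T i i) (S.Tr T) := by
  have h := hT.choose_spec.1.hasSum_trace B.basis
  have h1 : ∀ i, hT.choose (B.basis i) = T (B.vec i) := fun i => hT.choose_spec.2 (B.vec i)
  simp only [h1] at h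
  rw [Tr, dif_pos hT]
  exact h

/-- Matrix multiplication for a possibly unbounded `P`: factor `PQ = (P Δ^w)(Δ^(-w) Q)`, where the
first factor is bounded, and apply Parseval after moving it to the other side by its adjoint. -/
theorem hasSum_coef_mul {P : Module.End ℂ S.smooth} {w : ℂ}
    (hP : S.ExtendsToTraceClass (P * S.cpow w)) (Q : Module.End ℂ S.smooth) (k j : ι) :
    HasSum (fun i => B.coef P k i * B.coef Q i j) (B.coef (P * Q) k j) := by
  obtain ⟨A, -, hA⟩ := hP
  have h := B.basis.hasSum_inner_mul_inner (A.adjoint (B.basis k)) (S.cpow (-w) (Q (B.vec j)))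
  have h1 : ⟪A.adjoint (B.basis k), (S.cpow (-w) (Q (B.vec j)) : H)⟫_ℂ = B.coef (P * Q) k j := by
    rw [ContinuousLinearMap.adjoint_inner_left, hA, Module.End.mul_apply]
    have := B.cpow_neg_cpow (-w) (Q (B.vec j))
    rw [neg_neg] at this
    rw [this]
    rfl
  rw [h1] at h
  refine h.congr_fun fun i => ?_
  have h2 : ⟪A.adjoint (B.basis k), B.basis i⟫_ℂ = B.coef P k i * (B.eigenvalue i : ℂ) ^ w := by
    rw [ContinuousLinearMap.adjoint_inner_left, ← B.coef_mul_cpow]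
    exact congrArg _ (hA (B.vec i))
  have hw : (B.eigenvalue i : ℂ) ^ w * (B.eigenvalue i : ℂ) ^ (-w) = 1 := by
    rw [← Complex.cpow_add _ _ (B.eigenvalue_ne_zero i), add_neg_cancel, Complex.cpow_zero]
  rw [h2, B.inner_cpow]
  change B.coef P k i * B.coef Q i j = B.coef P k i * (B.eigenvalue i : ℂ) ^ w *
    ((B.eigenvalue i : ℂ) ^ (-w) * B.coef Q i j)
  linear_combination (-(B.coef P k i * B.coef Q i j)) * hw

theorem norm_eigenvalue_cpow (w : ℂ) (i : ι) :
    ‖(B.eigenvalue i : ℂ) ^ w‖ = B.eigenvalue i ^ w.re :=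
  Complex.norm_cpow_eq_rpow_re_of_pos (B.pos i) w

/-- Absolute convergence of `Tr (P Δ ^ a Q Δ ^ b)` as a double series, for operators `P Δ ^ t` and
`Δ ^ (a - t) Q Δ ^ b` of trace class. -/
theorem summable_coef_mul {P Q : Module.End ℂ S.smooth} {s t b : ℝ}
    (hP : S.ExtendsToTraceClass (P * S.cpow (t : ℂ)))
    (hQ : S.ExtendsToTraceClass (S.cpow (s : ℂ) * Q * S.cpow (b : ℂ))) :
    Summable fun q : ι × ι => ‖B.coef P q.1 q.2‖ * ‖B.coef Q q.2 q.1‖ *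
      (B.eigenvalue q.2 ^ (t + s) * B.eigenvalue q.1 ^ b) := by
  obtain ⟨A, hA, hA'⟩ := hP
  obtain ⟨C, hC, hC'⟩ := hQ
  refine (hC.summable_mul hA B.basis).congr fun q => ?_
  have h1 : ⟪B.basis q.2, C (B.basis q.1)⟫_ℂ = B.coef (S.cpow (s : ℂ) * Q * S.cpow (b : ℂ)) q.2 q.1 :=
    congrArg _ (hC' (B.vec q.1))
  have h2 : ⟪B.basis q.1, A (B.basis q.2)⟫_ℂ = B.coef (P * S.cpow (t : ℂ)) q.1 q.2 :=
    congrArg _ (hA' (B.vec q.2))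
  rw [h1, h2, B.coef_mul_cpow, B.coef_mul_cpow, B.coef_cpow_mul]
  simp only [norm_mul, norm_eigenvalue_cpow, Complex.ofReal_re]
  rw [Real.rpow_add (B.pos _)]
  ring

end EigenBasis

variable {H : Type*} [NormedAddCommGroup H] [InnerProductSpace ℂ H] [CompleteSpace H]

theorem Tr_add (S : PositiveOperator H) {T U : Module.End ℂ S.smooth}
    (hT : S.ExtendsToTraceClass T) (hU : S.ExtendsToTraceClass U)
    (hTU : S.ExtendsToTraceClass (T + U)) : S.Tr (T + U) = S.Tr T + S.Tr U := by
  obtain ⟨ι, ⟨B⟩⟩ := S.nonempty_eigenBasis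
  refine (B.hasSum_Tr hTU).unique ?_
  simpa only [B.coef_add] using (B.hasSum_Tr hT).add (B.hasSum_Tr hU)

theorem Tr_smul (S : PositiveOperator H) (c : ℂ) {T : Module.End ℂ S.smooth}
    (hT : S.ExtendsToTraceClass T) (hcT : S.ExtendsToTraceClass (c • T)) :
    S.Tr (c • T) = c * S.Tr T := by
  obtain ⟨ι, ⟨B⟩⟩ := S.nonempty_eigenBasis
  refine (B.hasSum_Tr hcT).unique ?_
  simpa only [B.coef_smul] using (B.hasSum_Tr hT).mul_left c

end PositiveOperator
end AbstractPDO

/-! ### Iterated commutators and the expansion of the zeta function -/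

namespace AbstractPDO
namespace PositiveOperator

variable {H : Type*} [NormedAddCommGroup H] [InnerProductSpace ℂ H] [CompleteSpace H]
  {S : PositiveOperator H}

/-- The operators `ad(Δ)^k(Q) Δ ^ (-k)`, as iterates of `T ↦ [Δ, T] Δ⁻¹` on `Q`. -/
noncomputable def adIter (S : PositiveOperator H) (Q : Module.End ℂ S.smooth) :
    ℕ → Module.End ℂ S.smooth
  | 0 => Q
  | k + 1 => (S.cpow 1 * adIter S Q k - adIter S Q k * S.cpow 1) * S.cpow (-1)

theorem EigenBasis.coef_adIter {ι : Type*} (B : S.EigenBasis ι) (Q : Module.End ℂ S.smooth) (k : ℕ)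
    (i j : ι) : B.coef (S.adIter Q k) i j =
      ((B.eigenvalue i / B.eigenvalue j : ℝ) - 1 : ℂ) ^ k * B.coef Q i j := by
  induction k with
  | zero => simp [adIter]
  | succ k ih =>
    have h := B.eigenvalue_ne_zero j
    rw [adIter, B.coef_mul_cpow, B.coef_sub, B.coef_cpow_mul, B.coef_mul_cpow, ih]
    rw [Complex.cpow_one, Complex.cpow_one, Complex.cpow_neg_one]
    push_cast
    linear_combination (-(((B.eigenvalue i : ℂ) / B.eigenvalue j - 1) ^ k * B.coef Q i j)) *
      mul_inv_cancel₀ h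

namespace PsiDOAlgebra

variable {r d : ℝ} (Ψ : S.PsiDOAlgebra r d)

theorem ofReal_mul_div_cancel (hr : 0 < r) (t : ℝ) : (((t * r : ℝ) : ℂ)) / r = t := by
  have : (r : ℂ) ≠ 0 := by exact_mod_cast hr.ne'
  push_cast
  field_simp

theorem mul_cpow_real_mem (hr : 0 < r) {m : ℝ} {P : Module.End ℂ S.smooth} (hP : P ∈ Ψ.filt m)
    (t : ℝ) : P * S.cpow (t : ℂ) ∈ Ψ.filt (t * r + m) := by
  simpa only [ofReal_mul_div_cancel hr, Complex.ofReal_re] using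
    Ψ.mul_cpow_mem m ((t * r : ℝ) : ℂ) P hP

theorem cpow_real_mul_mem (hr : 0 < r) {m : ℝ} {P : Module.End ℂ S.smooth} (hP : P ∈ Ψ.filt m)
    (t : ℝ) : S.cpow (t : ℂ) * P ∈ Ψ.filt (t * r + m) := by
  simpa only [ofReal_mul_div_cancel hr, Complex.ofReal_re] using
    Ψ.cpow_mul_mem m ((t * r : ℝ) : ℂ) P hP

/-- The commutator with `Δ` raises the order by `r - 1` and `Δ⁻¹` lowers it by `r`: a net loss of
one per step. -/
theorem adIter_mem (hr : 0 < r) {n : ℝ} {Q : Module.End ℂ S.smooth} (hQ : Q ∈ Ψ.filt n) (k : ℕ) :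
    S.adIter Q k ∈ Ψ.filt (n - k) := by
  induction k with
  | zero => simpa [adIter] using hQ
  | succ k ih =>
    have h1 := Ψ.comm_mem _ ((1 * r : ℝ) : ℂ) _ ih
    rw [ofReal_mul_div_cancel hr, Complex.ofReal_one, Complex.ofReal_re] at h1
    have h2 := Ψ.mul_cpow_real_mem hr h1 (-1)
    rw [Complex.ofReal_neg, Complex.ofReal_one] at h2
    have h3 : n - ((k + 1 : ℕ) : ℝ) = -1 * r + (1 * r + (n - k) - 1) := by push_cast; ring
    rw [h3]
    exact h2

theorem extends_of_mem {m : ℝ} {P : Module.End ℂ S.smooth} (hP : P ∈ Ψ.filt m) (hm : m < -d) :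
    S.ExtendsToTraceClass P :=
  (Ψ.hasOrder m P hP).2 hm

theorem extends_zeta {m : ℝ} {P : Module.End ℂ S.smooth} (hP : P ∈ Ψ.filt m) {z : ℂ}
    (hz : m + d < z.re) : S.ExtendsToTraceClass (P * S.cpow (-z / r)) := by
  refine Ψ.extends_of_mem (Ψ.mul_cpow_mem m (-z) P hP) ?_
  rw [Complex.neg_re]
  linarith

section Coefficients

variable {ι : Type*} (B : S.EigenBasis ι) {m n : ℝ} {P Q : Module.End ℂ S.smooth}

include Ψ in
theorem summable_coef_mul (hr : 0 < r) (hP : P ∈ Ψ.filt m) (hQ : Q ∈ Ψ.filt n) {a b : ℝ}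
    (h : m + n + (a + b) * r < -2 * d - 1) :
    Summable fun q : ι × ι => ‖B.coef P q.1 q.2‖ * ‖B.coef Q q.2 q.1‖ *
      (B.eigenvalue q.2 ^ a * B.eigenvalue q.1 ^ b) := by
  -- Chosen so that `P Δ^t` has order `-d - 1`; the hypothesis then leaves order below `-d` for
  -- `Δ^(a - t) Q Δ^b`, so both factors are of trace class.
  set t : ℝ := (-d - 1 - m) / r with ht
  have htr : t * r = -d - 1 - m := div_mul_cancel₀ _ hr.ne'
  have h1 := B.summable_coef_mul (s := a - t) (t := t) (b := b)
    (Ψ.extends_of_mem (Ψ.mul_cpow_real_mem hr hP t) (by linarith))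
    (Ψ.extends_of_mem (Ψ.mul_cpow_real_mem hr (Ψ.cpow_real_mul_mem hr hQ (a - t)) b) (by
      rw [sub_mul, htr]; linarith))
  simpa using h1

include Ψ in
theorem hasSum_zeta_mul (hr : 0 < r) (hd : 0 ≤ d) (hP : P ∈ Ψ.filt m) (hQ : Q ∈ Ψ.filt n) {z : ℂ}
    (hz : m + n + 2 * d + 1 < z.re) :
    HasSum (fun q : ι × ι => B.coef P q.1 q.2 * B.coef Q q.2 q.1 *
      (B.eigenvalue q.1 : ℂ) ^ (-z / r)) (S.zeta r (P * Q) z) := by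
  have hre : (-z / (r : ℂ)).re = -z.re / r := by rw [Complex.div_ofReal_re, Complex.neg_re]
  have hsum : Summable fun q : ι × ι => B.coef P q.1 q.2 * B.coef Q q.2 q.1 *
      (B.eigenvalue q.1 : ℂ) ^ (-z / r) := by
    refine Summable.of_norm ((Ψ.summable_coef_mul B hr hP hQ (a := 0) (b := -z.re / r) ?_).congr
      fun q => ?_)
    · rw [zero_add, div_mul_cancel₀ _ hr.ne']
      linarith
    · rw [norm_mul, norm_mul, B.norm_eigenvalue_cpow, hre, Real.rpow_zero, one_mul]
  set t : ℝ := (-d - 1 - m) / r with ht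
  have htr : t * r = -d - 1 - m := div_mul_cancel₀ _ hr.ne'
  have hPt : S.ExtendsToTraceClass (P * S.cpow (t : ℂ)) :=
    Ψ.extends_of_mem (Ψ.mul_cpow_real_mem hr hP t) (by linarith)
  have h1 := hsum.hasSum.prod_fiberwise fun j =>
    (B.hasSum_coef_mul hPt Q j j).mul_right ((B.eigenvalue j : ℂ) ^ (-z / r))
  have h2 := B.hasSum_Tr (Ψ.extends_zeta (Ψ.mul_mem m n P Q hP hQ) (z := z) (by linarith))
  simp only [B.coef_mul_cpow] at h2
  rw [zeta, h2.unique h1]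
  exact hsum.hasSum

/-- The term of index `(j, i)` in the remainder of the expansion of `ζ_{QP}`. -/
noncomputable def _root_.AbstractPDO.PositiveOperator.EigenBasis.remTerm (B : S.EigenBasis ι)
    (r : ℝ) (P Q : Module.End ℂ S.smooth) (N : ℕ) (z : ℂ) (q : ι × ι) : ℂ :=
  B.coef P q.1 q.2 * B.coef Q q.2 q.1 * (B.eigenvalue q.1 : ℂ) ^ (-z / r) *
    negBinomRem N (z / r) (B.eigenvalue q.2 / B.eigenvalue q.1)

include Ψ in
theorem hasSum_remTerm (hr : 0 < r) (hd : 0 ≤ d) (hP : P ∈ Ψ.filt m) (hQ : Q ∈ Ψ.filt n) (N : ℕ)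
    {z : ℂ} (hz : m + n + 2 * d + 1 < z.re) :
    HasSum (B.remTerm r P Q N z) (S.zeta r (Q * P) z -
      ∑ k ∈ Finset.range N, negBinom (z / r) k * S.zeta r (P * S.adIter Q k) z) := by
  -- Swapping the indices gives the series for `QP` the coefficients of the series for `PQ`, with
  -- the weight on the other eigenvalue.
  have h1 := (Equiv.prodComm ι ι).hasSum_iff.2
    (Ψ.hasSum_zeta_mul B hr hd hQ hP (z := z) (by linarith))
  have h2 := hasSum_sum (s := Finset.range N) fun k _ =>
    (Ψ.hasSum_zeta_mul B hr hd hP (Ψ.adIter_mem hr hQ k) (z := z) (by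
      have : (0 : ℝ) ≤ k := k.cast_nonneg
      linarith)).mul_left (negBinom (z / r) k)
  refine (h1.sub h2).congr_fun fun q => ?_
  have hpow : (B.eigenvalue q.2 : ℂ) ^ (-z / r) = (B.eigenvalue q.1 : ℂ) ^ (-z / r) *
      ((B.eigenvalue q.2 / B.eigenvalue q.1 : ℝ) : ℂ) ^ (-(z / r)) := by
    rw [neg_div, ← Complex.mul_cpow_ofReal_nonneg (B.pos _).le
      (div_pos (B.pos _) (B.pos _)).le, ← Complex.ofReal_mul, mul_div_cancel₀ _ (B.pos _).ne']
  simp only [Function.comp_apply, Equiv.prodComm_apply, Prod.fst_swap, Prod.snd_swap]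
  rw [hpow, EigenBasis.remTerm, negBinomRem, mul_sub, Finset.mul_sum]
  congr 1
  · ring
  · refine Finset.sum_congr rfl fun k _ => ?_
    rw [B.coef_adIter]
    ring

/-- Eigenvalues may lie on either side of `1`, so both extreme exponents are needed for a bound
uniform in `s`. -/
theorem rpow_le_add_of_abs_le {x s ρ : ℝ} (hx : 0 < x) (h : |s| ≤ ρ) (a : ℝ) :
    x ^ (s + a) ≤ x ^ (ρ + a) + x ^ (-ρ + a) := by
  obtain ⟨h1, h2⟩ := abs_le.1 h
  rcases le_total 1 x with hx1 | hx1
  · exact (Real.rpow_le_rpow_of_exponent_le hx1 (by linarith)).trans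
      (le_add_of_nonneg_right (Real.rpow_nonneg hx.le _))
  · exact (Real.rpow_le_rpow_of_exponent_ge hx hx1 (by linarith)).trans
      (le_add_of_nonneg_left (Real.rpow_nonneg hx.le _))

/-- A majorant independent of `z` in the disc. The factor `|y / x - 1|^N` from the Taylor remainder
turns `Q` into its `N`-th iterated commutator, and each of the four eigenvalue monomials has total
exponent `±R/r`. -/
theorem norm_remTerm_le (hr : 0 < r) (N : ℕ) {R : ℝ} {z : ℂ} (hz : ‖z‖ < R) (q : ι × ι) :
    ‖B.remTerm r P Q N z q‖ ≤ (∏ k ∈ Finset.range N, (R / r + k)) *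
      (‖B.coef P q.1 q.2‖ * ‖B.coef (S.adIter Q N) q.2 q.1‖ *
        (B.eigenvalue q.1 ^ (R / r) + B.eigenvalue q.1 ^ (-(R / r)) +
          (B.eigenvalue q.2 ^ (R / r - N) + B.eigenvalue q.2 ^ (-(R / r) - N)) *
            B.eigenvalue q.1 ^ (N : ℝ))) := by
  set x := B.eigenvalue q.1 with hx
  set y := B.eigenvalue q.2 with hy
  have hx0 : 0 < x := B.pos _
  have hy0 : 0 < y := B.pos _
  have hw : ‖z / (r : ℂ)‖ ≤ R / r := by
    rw [norm_div, Complex.norm_real, Real.norm_of_nonneg hr.le]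
    exact div_le_div_of_nonneg_right hz.le hr.le
  set w : ℂ := z / r with hwdef
  have hσ : |-w.re| ≤ R / r := by
    rw [abs_neg]; exact (Complex.abs_re_le_norm w).trans hw
  have h1 := norm_negBinomRem_le N w (y / x) (div_pos hy0 hx0)
  have h2 : ‖B.coef (S.adIter Q N) q.2 q.1‖ = |y / x - 1| ^ N * ‖B.coef Q q.2 q.1‖ := by
    rw [B.coef_adIter, norm_mul, norm_pow, ← Real.norm_eq_abs, ← Complex.norm_real]
    push_cast
    rfl
  have h3 : ∏ k ∈ Finset.range N, ‖w + k‖ ≤ ∏ k ∈ Finset.range N, (R / r + k) := by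
    refine Finset.prod_le_prod (fun _ _ => norm_nonneg _) fun k _ => ?_
    refine (norm_add_le _ _).trans ?_
    rw [Complex.norm_natCast]
    exact add_le_add_left hw _
  have h4 : x ^ (-w.re) * max 1 ((y / x) ^ (-w.re - N)) ≤ x ^ (R / r) + x ^ (-(R / r)) +
      (y ^ (R / r - N) + y ^ (-(R / r) - N)) * x ^ (N : ℝ) := by
    have h5 := rpow_le_add_of_abs_le hx0 hσ 0
    have h6 := rpow_le_add_of_abs_le hy0 hσ (-N)
    simp only [add_zero, ← sub_eq_add_neg] at h5 h6
    rw [mul_max_of_nonneg _ _ (Real.rpow_nonneg hx0.le _), mul_one]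
    have h7 : x ^ (-w.re) * (y / x) ^ (-w.re - N) = y ^ (-w.re - N) * x ^ (N : ℝ) := by
      rw [Real.div_rpow hy0.le hx0.le, Real.rpow_sub hx0]
      have := (Real.rpow_pos_of_pos hx0 (-w.re)).ne'
      have := (Real.rpow_pos_of_pos hx0 (N : ℝ)).ne'
      field_simp
    rw [h7]
    refine max_le (h5.trans (le_add_of_nonneg_right (by positivity))) ?_
    exact (mul_le_mul_of_nonneg_right h6 (Real.rpow_nonneg hx0.le _)).trans
      (le_add_of_nonneg_left (by positivity))
  have hre : (-z / (r : ℂ)).re = -w.re := by rw [neg_div, Complex.neg_re]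
  rw [EigenBasis.remTerm, norm_mul, norm_mul, norm_mul, B.norm_eigenvalue_cpow, hre, h2]
  calc ‖B.coef P q.1 q.2‖ * ‖B.coef Q q.2 q.1‖ * x ^ (-w.re) * ‖negBinomRem N w (y / x)‖
      ≤ ‖B.coef P q.1 q.2‖ * ‖B.coef Q q.2 q.1‖ * x ^ (-w.re) *
        ((∏ k ∈ Finset.range N, ‖w + k‖) * (|y / x - 1| ^ N * max 1 ((y / x) ^ (-w.re - N)))) :=
        mul_le_mul_of_nonneg_left h1 (by positivity)
    _ = (∏ k ∈ Finset.range N, ‖w + k‖) * (‖B.coef P q.1 q.2‖ *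
        (|y / x - 1| ^ N * ‖B.coef Q q.2 q.1‖) *
          (x ^ (-w.re) * max 1 ((y / x) ^ (-w.re - N)))) := by ring
    _ ≤ _ := by
        have hR : 0 ≤ R / r := (norm_nonneg w).trans hw
        refine mul_le_mul h3 (mul_le_mul_of_nonneg_left h4 (by positivity)) (by positivity) ?_
        exact Finset.prod_nonneg fun k _ => by positivity

include Ψ in
-- Weierstrass' test: the iterated commutator has order `n - N`, which outweighs the growth `R`
-- allowed on the disc.
theorem differentiableOn_tsum_remTerm (hr : 0 < r) (hP : P ∈ Ψ.filt m)
    (hQ : Q ∈ Ψ.filt n) {R : ℝ} (hR : 0 ≤ R) {N : ℕ} (hN : m + n + 2 * d + 1 + R < N) :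
    DifferentiableOn ℂ (fun z => ∑' q, B.remTerm r P Q N z q) (Metric.ball 0 R) := by
  have hRr : R / r * r = R := div_mul_cancel₀ _ hr.ne'
  have hs : ∀ {a b : ℝ}, (a + b) * r ≤ R → Summable fun q : ι × ι => ‖B.coef P q.1 q.2‖ *
      ‖B.coef (S.adIter Q N) q.2 q.1‖ * (B.eigenvalue q.2 ^ a * B.eigenvalue q.1 ^ b) := fun h =>
    Ψ.summable_coef_mul B hr hP (Ψ.adIter_mem hr hQ N) (by linarith)
  have h1 := hs (a := 0) (b := R / r) (by rw [zero_add, hRr])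
  have h2 := hs (a := 0) (b := -(R / r)) (by rw [zero_add, neg_mul, hRr]; linarith)
  have h3 := hs (a := R / r - N) (b := N) (by rw [sub_add_cancel, hRr])
  have h4 := hs (a := -(R / r) - N) (b := N) (by rw [sub_add_cancel, neg_mul, hRr]; linarith)
  have hsum := (((h1.add h2).add (h3.add h4)).mul_left (∏ k ∈ Finset.range N, (R / r + k)))
  refine Complex.differentiableOn_tsum_of_summable_norm hsum (fun q => ?_) Metric.isOpen_ball
    fun q z hz => ?_
  · unfold EigenBasis.remTerm
    refine Differentiable.differentiableOn (Differentiable.mul (Differentiable.const_mul ?_ _) ?_)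
    · exact Differentiable.const_cpow (by fun_prop) (Or.inl (B.eigenvalue_ne_zero _))
    · exact (differentiable_negBinomRem N (div_pos (B.pos _) (B.pos _))).comp
        (differentiable_id.div_const _)
  · refine (norm_remTerm_le B hr N (by simpa using hz) q).trans (le_of_eq ?_)
    simp only [Real.rpow_zero]
    ring

end Coefficients

/-- Near `0`, the zeta functions of `QP` and of the operators `P ad(Δ)^k(Q) Δ ^ (-k)` satisfy a
binomial expansion up to a holomorphic function. -/
theorem exists_zeta_expansion (hr : 0 < r) (hd : 0 ≤ d) {m n : ℝ} {P Q : Module.End ℂ S.smooth}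
    (hP : P ∈ Ψ.filt m) (hQ : Q ∈ Ψ.filt n) {F : ℂ → ℂ}
    (hF : S.IsZetaContinuation r (Q * P) F) {G : ℕ → ℂ → ℂ}
    (hG : ∀ k, S.IsZetaContinuation r (P * S.adIter Q k) (G k)) :
    ∃ (N : ℕ) (h : ℂ → ℂ), AnalyticAt ℂ h 0 ∧
      F =ᶠ[𝓝[≠] 0] fun z => ∑ k ∈ Finset.range (N + 1), negBinom (z / r) k * G k z + h z := by
  obtain ⟨ι, ⟨B⟩⟩ := S.nonempty_eigenBasis
  set c : ℝ := max (m + n + 2 * d + 1) 0 with hc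
  have hc0 : 0 ≤ c := le_max_right _ _
  -- Base point of the identity theorem: it lies in the half-plane of absolute convergence, and the
  -- disc of radius `c + 2` contains both it and `0`.
  set x : ℂ := ((c + 1 : ℝ) : ℂ) with hx
  have hxre : m + n + 2 * d + 1 < x.re := by
    rw [hx, Complex.ofReal_re]; exact (le_max_left _ _).trans_lt (lt_add_one _)
  obtain ⟨N, hN⟩ := exists_nat_gt (m + n + 2 * d + 1 + (c + 2))
  set h : ℂ → ℂ := fun z => ∑' q, B.remTerm r P Q (N + 1) z q with hh
  have hdiff : DifferentiableOn ℂ h (Metric.ball 0 (c + 2)) :=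
    Ψ.differentiableOn_tsum_remTerm B hr hP hQ (by linarith) (by push_cast; linarith)
  have han := hdiff.analyticOnNhd Metric.isOpen_ball
  have h0 : (0 : ℂ) ∈ Metric.ball (0 : ℂ) (c + 2) := Metric.mem_ball_self (by linarith)
  refine ⟨N, h, han 0 h0, ?_⟩
  have hxball : x ∈ Metric.ball (0 : ℂ) (c + 2) := by
    rw [mem_ball_zero_iff, hx, Complex.norm_real, Real.norm_of_nonneg (by linarith)]
    linarith
  refine meromorphicOn_eventuallyEq_of_isPreconnected (U := Metric.ball 0 (c + 2))
    (fun z _ => hF.1 z) (fun z hz => ?_) (convex_ball 0 _).isPreconnected hxball h0 ?_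
  · refine MeromorphicAt.add (MeromorphicAt.fun_sum fun k _ => MeromorphicAt.mul ?_ ((hG k).1 z))
      (han z hz).meromorphicAt
    exact (((differentiable_negBinom k).comp (differentiable_id.div_const (r : ℂ))).analyticAt
      z).meromorphicAt
  · have hFx := hF.eventuallyEq_zeta (Ψ.zeta_holomorphic _ _ (Ψ.mul_mem n m Q P hQ hP)) (x := x)
      (by linarith)
    have hGx : ∀ k ∈ Finset.range (N + 1), G k =ᶠ[𝓝[≠] x] S.zeta r (P * S.adIter Q k) :=
      fun k _ => (hG k).eventuallyEq_zeta (Ψ.zeta_holomorphic _ _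
        (Ψ.mul_mem m _ P _ hP (Ψ.adIter_mem hr hQ k))) (by
          have : (0 : ℝ) ≤ k := k.cast_nonneg
          linarith)
    have hopen : IsOpen {z : ℂ | m + n + 2 * d + 1 < z.re} :=
      isOpen_lt continuous_const Complex.continuous_re
    filter_upwards [hFx, (Finset.eventually_all _).2 hGx,
      nhdsWithin_le_nhds (hopen.mem_nhds hxre)] with z hFz hGz hz
    have h1 := (Ψ.hasSum_remTerm B hr hd hP hQ (N + 1) hz).tsum_eq
    have h2 : ∑ k ∈ Finset.range (N + 1), negBinom (z / r) k * G k z =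
        ∑ k ∈ Finset.range (N + 1), negBinom (z / r) k * S.zeta r (P * S.adIter Q k) z :=
      Finset.sum_congr rfl fun k hk => by rw [hGz k hk]
    rw [hFz, h2, hh]
    simp only
    rw [h1]
    ring

end PsiDOAlgebra

end PositiveOperator
end AbstractPDO

/-! ### The trace property -/

namespace AbstractPDO
namespace PositiveOperator
namespace PsiDOAlgebra

variable {H : Type*} [NormedAddCommGroup H] [InnerProductSpace ℂ H] [CompleteSpace H]
  {S : PositiveOperator H} {r d : ℝ} (Ψ : S.PsiDOAlgebra r d)

theorem isZetaContinuation_add {P Q : Module.End ℂ S.smooth} (hP : P ∈ Ψ.algebra)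
    (hQ : Q ∈ Ψ.algebra) {F G : ℂ → ℂ} (hF : S.IsZetaContinuation r P F)
    (hG : S.IsZetaContinuation r Q G) : S.IsZetaContinuation r (P + Q) (F + G) := by
  obtain ⟨m, hm⟩ := hP
  obtain ⟨n, hn⟩ := hQ
  obtain ⟨hF, c, hc⟩ := hF
  obtain ⟨hG, c', hc'⟩ := hG
  have hm' := Ψ.mono (le_max_left m n) hm
  have hn' := Ψ.mono (le_max_right m n) hn
  -- Far enough to the right for all three operators to be of trace class, since `Tr` takes a
  -- default value otherwise.
  refine ⟨hF.add hG, max (max m n + d) (max c c'), fun z hz => ?_⟩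
  obtain ⟨hz1, hz2⟩ := max_lt_iff.1 hz
  obtain ⟨hz2, hz3⟩ := max_lt_iff.1 hz2
  have h3 := Ψ.extends_zeta ((Ψ.filt _).add_mem hm' hn') hz1
  rw [add_mul] at h3
  rw [Pi.add_apply, hc z hz2, hc' z hz3, zeta, zeta, zeta, add_mul,
    S.Tr_add (Ψ.extends_zeta hm' hz1) (Ψ.extends_zeta hn' hz1) h3]

theorem isZetaContinuation_smul {P : Module.End ℂ S.smooth} (hP : P ∈ Ψ.algebra) (a : ℂ)
    {F : ℂ → ℂ} (hF : S.IsZetaContinuation r P F) : S.IsZetaContinuation r (a • P) (a • F) := by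
  obtain ⟨m, hm⟩ := hP
  obtain ⟨hF, c, hc⟩ := hF
  refine ⟨hF.const_smul a, max (m + d) c, fun z hz => ?_⟩
  obtain ⟨hz1, hz2⟩ := max_lt_iff.1 hz
  have h3 := Ψ.extends_zeta ((Ψ.filt _).smul_mem a hm) hz1
  rw [smul_mul_assoc] at h3
  rw [Pi.smul_apply, hc z hz2, zeta, zeta, smul_mul_assoc,
    S.Tr_smul a (Ψ.extends_zeta hm hz1) h3, smul_eq_mul]

/-- The leading coefficients at `0` of the zeta functions of `PQ` and `QP` coincide. -/
theorem tendsto_zeta_mul_comm (hr : 0 < r) (hd : 0 ≤ d) {p : ℕ} (hp : 1 ≤ p)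
    (hpole : Ψ.HasPoleOfOrderAtZero p) {P Q : Module.End ℂ S.smooth} (hP : P ∈ Ψ.algebra)
    (hQ : Q ∈ Ψ.algebra) {F F' : ℂ → ℂ} (hF : S.IsZetaContinuation r (P * Q) F)
    (hF' : S.IsZetaContinuation r (Q * P) F') {a : ℂ}
    (ha : Tendsto (fun z => z ^ p * F z) (𝓝[≠] 0) (𝓝 a)) :
    Tendsto (fun z => z ^ p * F' z) (𝓝[≠] 0) (𝓝 a) := by
  obtain ⟨m, hP⟩ := hP
  obtain ⟨n, hQ⟩ := hQ
  have hmem : ∀ k : ℕ, P * S.adIter Q k ∈ Ψ.filt (m + (n - k)) := fun k =>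
    Ψ.mul_mem m _ P _ hP (Ψ.adIter_mem hr hQ k)
  choose G hG using fun k => Ψ.zeta_meromorphic _ _ (hmem k)
  obtain ⟨N, h, han, heq⟩ := Ψ.exists_zeta_expansion hr hd hP hQ hF' hG
  -- `adIter Q 0` is `Q`, so `G 0` and `F` both continue the zeta function of `P * Q`.
  have h0 : Tendsto (fun z => z ^ p * G 0 z) (𝓝[≠] 0) (𝓝 a) := by
    refine ha.congr' ?_
    filter_upwards [hF.eventuallyEq (hG 0) 0] with z hz
    rw [hz]
  have hterm : ∀ k, Tendsto (fun z => negBinom (z / r) (k + 1) * (z ^ p * G (k + 1) z))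
      (𝓝[≠] 0) (𝓝 0) := by
    intro k
    obtain ⟨b, hb⟩ := exists_tendsto_pow_mul ((hG (k + 1)).1 0)
      (hpole.1 _ ⟨_, hmem (k + 1)⟩ _ (hG (k + 1)))
    have h1 : Tendsto (fun z : ℂ => negBinom (z / r) (k + 1)) (𝓝[≠] 0) (𝓝 0) := by
      have hc : Continuous fun z : ℂ => negBinom (z / r) (k + 1) :=
        (differentiable_negBinom (k + 1)).continuous.comp (continuous_id.div_const _)
      have := (hc.tendsto 0).mono_left (nhdsWithin_le_nhds (s := {0}ᶜ))
      rwa [zero_div, negBinom_at_zero (Nat.le_add_left 1 k)] at this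
    simpa using h1.mul hb
  have hrem : Tendsto (fun z => z ^ p * h z) (𝓝[≠] 0) (𝓝 0) := by
    have hc : ContinuousAt (fun z : ℂ => z ^ p * h z) 0 :=
      ((continuous_pow p).continuousAt).mul han.continuousAt
    have := hc.tendsto.mono_left (nhdsWithin_le_nhds (s := {0}ᶜ))
    simpa [Nat.one_le_iff_ne_zero.1 hp] using this
  have hlim := ((tendsto_finsetSum (Finset.range N) fun k _ => hterm k).add h0).add hrem
  rw [Finset.sum_const_zero, zero_add, add_zero] at hlim
  refine hlim.congr' ?_
  filter_upwards [heq] with z hz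
  rw [hz, Finset.sum_range_succ', negBinom_zero, mul_add, mul_add, Finset.mul_sum]
  congr 2
  · exact Finset.sum_congr rfl fun k _ => by ring
  · ring

end PsiDOAlgebra
end PositiveOperator
end AbstractPDO

theorem mainTheorem3 {H : Type*} [NormedAddCommGroup H] [InnerProductSpace ℂ H] [CompleteSpace H]
    (S : AbstractPDO.PositiveOperator H)
    (D : S.DiffOpAlgebra) (d : ℝ) (hd : D.IsAnalyticDimension d) (hD : D.HasAnalyticContinuation)
    (Ψ : S.PsiDOAlgebra D.order d)
    (p : ℕ) (hp : 1 ≤ p) (hpole : Ψ.HasPoleOfOrderAtZero p) :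
    ∃ τ : Ψ.algebra →ₗ[ℂ] ℂ,
      (∀ (P : Ψ.algebra) (F : ℂ → ℂ),
        S.IsZetaContinuation D.order (P : Module.End ℂ S.smooth) F →
          AbstractPDO.HasResidueAt (fun z => z ^ (p - 1) * F z) 0 (τ P)) ∧
      ∀ P Q : Ψ.algebra, τ (P * Q) = τ (Q * P) := by

  have hr := D.order_pos
  -- The limit is independent of the continuation, so it can define the functional; linearity and
  -- symmetry then follow from uniqueness of limits.
  have hlim : ∀ P : Ψ.algebra, ∃ a : ℂ, ∀ F,
      S.IsZetaContinuation D.order (P : Module.End ℂ S.smooth) F →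
        Tendsto (fun z => z ^ p * F z) (𝓝[≠] 0) (𝓝 a) := by
    rintro ⟨P, m, hP⟩
    obtain ⟨F, hF⟩ := Ψ.zeta_meromorphic m P hP
    obtain ⟨a, ha⟩ := AbstractPDO.exists_tendsto_pow_mul (hF.1 0) (hpole.1 P ⟨m, hP⟩ F hF)
    refine ⟨a, fun G hG => ha.congr' ?_⟩
    filter_upwards [hF.eventuallyEq hG 0] with z hz
    rw [hz]
  have hcont : ∀ P : Ψ.algebra,
      ∃ F, S.IsZetaContinuation D.order (P : Module.End ℂ S.smooth) F := by
    rintro ⟨P, m, hP⟩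
    exact Ψ.zeta_meromorphic m P hP
  choose t ht using hlim
  refine ⟨{ toFun := t, map_add' := ?_, map_smul' := ?_ }, fun P F hF =>
    AbstractPDO.hasResidueAt_of_tendsto hp (hF.1 0) (ht P F hF), ?_⟩
  · intro P Q
    obtain ⟨F, hF⟩ := hcont P
    obtain ⟨G, hG⟩ := hcont Q
    refine tendsto_nhds_unique (ht (P + Q) (F + G) (Ψ.isZetaContinuation_add P.2 Q.2 hF hG)) ?_
    simpa only [Pi.add_apply, mul_add] using (ht P F hF).add (ht Q G hG)
  · intro a P
    obtain ⟨F, hF⟩ := hcont P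
    refine tendsto_nhds_unique (ht (a • P) (a • F) (Ψ.isZetaContinuation_smul P.2 a hF)) ?_
    simpa only [Pi.smul_apply, smul_eq_mul, mul_left_comm] using! (ht P F hF).const_mul a
  · intro P Q
    obtain ⟨F, hF⟩ := hcont (P * Q)
    obtain ⟨G, hG⟩ := hcont (Q * P)
    exact tendsto_nhds_unique (Ψ.tendsto_zeta_mul_comm hr hd.1.1 hp hpole P.2 Q.2 hF hG
      (ht _ F hF)) (ht _ G hG)
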